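/- Let $k \ge 2$ and $b \ge 3$ be integers, and let $d_1, d_2 \in \{0,1,\dots,b-1\}$ be distinct and coprime. Let $n$ be a natural number divisible by $k$, and set $N := b^n$ and $B := b^{6k^2}$. Let $\mu_n$ be the uniform probability measure on the set of $k$th powers of $n$-digit numbers in base $b$ with all digits in $\{d_1,d_2\}$ (leading zeros allowed); that is, for $m \in \mathbf{Z}$, $\mu_n(m) = 2^{-n}$ if $m = \big(\sum_{i=0}^{n-1} x_i b^i\big)^k$ for some $x_0,\dots,x_{n-1} \in \{d_1,d_2\}$, and $\mu_n(m) = 0$ otherwise. For $\theta \in \mathbf{R}$ write $\widehat{\mu_n}(\theta) := \sum_{m \in \mathbf{Z}} \mu_n(m) e^{2\pi i m\theta}$, and for $x \in \mathbf{R}$ let $\Vert x \Vert$ be the distance from $x$ to the nearest integer. Let $\delta \in (0,1)$ and $\theta \in \mathbf{R}$, and suppose that $|\widehat{\mu_n}(\theta)| \ge \delta$ and $N \ge (2/\delta)^B$. Then there is a positive integer $q \le (2/\delta)^B$ such that $\Vert \theta q \Vert \le (2/\delta)^B N^{-k}$. -/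

import Mathlib

noncomputable section

namespace RestrictedDigits

/-- `e(x) = exp(2 π i x)`. -/
def e (x : ℝ) : ℂ := Complex.exp (2 * Real.pi * Complex.I * x)

/-- The distance from the real number `x` to the nearest integer. -/
def distInt (x : ℝ) : ℝ := |x - round x|

/-- The set of all `k`-th powers of the integers `∑ i < n, x i * b ^ i` whose `n` digits `x i`
in base `b` (leading zeros being allowed if zero is one of the two digits) all lie in
`{d₁, d₂}`. -/
def powerSet (b k d₁ d₂ n : ℕ) : Set ℤ :=
  {m | ∃ x : Fin n → ℕ, (∀ i, x i = d₁ ∨ x i = d₂) ∧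
    m = (∑ i : Fin n, (x i : ℤ) * (b : ℤ) ^ (i : ℕ)) ^ k}

/-- The uniform probability mass `μ_n` on `powerSet b k d₁ d₂ n`: it is `2 ^ (-n)` on this set
and `0` off it. -/
def mu (b k d₁ d₂ n : ℕ) (m : ℤ) : ℝ :=
  (powerSet b k d₁ d₂ n).indicator (fun _ => ((2 : ℝ) ^ n)⁻¹) m

/-- The Fourier transform `∑ m, μ(m) e(m θ)` of a function `μ` on the integers (for `mu` the
sum has only finitely many nonzero terms). -/
def fourierTransform (μ : ℤ → ℝ) (θ : ℝ) : ℂ :=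
  ∑' m : ℤ, (μ m : ℂ) * e (m * θ)

end RestrictedDigits

end

/-!
Write `k = d + 2`, `Q = b ^ k`, `N = b ^ n = Q ^ m`. Splitting the digits by their position modulo
`k`, the Fourier transform becomes an average of `e (θ X ^ k)` over `X = ∑ j < k, b ^ j * X_j`,
where the `X_j` are independent and range over the integers with `m` digits in base `Q`, all of
them `d₁` or `d₂`. Every `X_j` thus has the full length `N`.

*Differencing.* Weyl differencing in all but one of the `X_j` (`weyl_differencing`) gives a phase
`c * ∏ (L(ω_j) - L(ω'_j)) * L(w)`, linear in the last variable, where `c` is a bounded integer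
multiple of `θ` and `L(ω)` runs over the integers with digits `0`, `1` in base `Q`. The sum over
`w` is a Riesz product, and it is large only if `t = c * ∏ (L(ω_j) - L(ω'_j))` has small `energy`
`∑ l < m, ‖t Q ^ l‖²`, i.e. has `O(log (2 / δ))` nonzero centred digits among its first `m`.

*Filling in.* The energy is controlled on sums of `Q - 1` terms. As the `(Q - 1)`-fold sumset of a
dense set of integers with digits `0`, `1` is dense in `[0, N)` (`density_pow_le_card_nsmul`,
which is a tensor power of a one-dimensional inequality), the energy of `c * ∏ (z_j - s_j)` is
small for a positive proportion, polynomial in `δ`, of the `(k - 1)`-tuples `z` of integers in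
`[0, N)` (`exists_energy_le_of_digitSum`).

*Recurrence.* Look at a window of `K * D` digits, where `D` bounds the number of nonzero ones.
There are at most `(6 Q K) ^ D` patterns, far fewer than `Q ^ (K * D)` when `K` is large; so a
popular pattern puts many of the `c * Q ^ i₀ * ∏ (z_j - s_j)` in an arc that is much shorter than
their density (`exists_cluster`). Vinogradov's lemma, applied to one variable after another
(`exists_distInt_mul_le_of_prod`), yields `q` with `‖c Q ^ i₀ q‖` at most a power of `2 / δ` times
`N ^ (1 - k)`. With the first window, `i₀ = 0`, this is a factor of `N` short of the claim. The
last window, ending at `m`, supplies the missing factor: by the first one `c * q` is so close to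
an integer that the error may be divided by `Q ^ i₀` (`exists_distInt_le_of_energy_le`).
-/

namespace RestrictedDigits

/-! ### Distance to the nearest integer -/

lemma distInt_nonneg (x : ℝ) : 0 ≤ distInt x := abs_nonneg _

lemma distInt_le_abs_sub (x : ℝ) (z : ℤ) : distInt x ≤ |x - z| := round_le x z

lemma distInt_le_abs (x : ℝ) : distInt x ≤ |x| := by
  simpa using distInt_le_abs_sub x 0

lemma distInt_add_le (x y : ℝ) : distInt (x + y) ≤ distInt x + distInt y := by
  refine (distInt_le_abs_sub (x + y) (round x + round y)).trans ?_
  have : x + y - ((round x + round y : ℤ) : ℝ) = (x - round x) + (y - round y) := by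
    push_cast; ring
  rw [this]
  exact abs_add_le _ _

lemma distInt_neg (x : ℝ) : distInt (-x) = distInt x := by
  have h : ∀ y : ℝ, distInt (-y) ≤ distInt y := fun y ↦ by
    refine (distInt_le_abs_sub (-y) (-round y)).trans_eq ?_
    rw [distInt, ← abs_neg]
    push_cast
    ring_nf
  exact le_antisymm (h x) (by simpa using h (-x))

lemma distInt_sub_le (x y : ℝ) : distInt (x - y) ≤ distInt x + distInt y := by
  simpa [sub_eq_add_neg, distInt_neg] using distInt_add_le x (-y)

lemma distInt_mul_natCast_le (x : ℝ) (q : ℕ) : distInt (x * q) ≤ distInt x * q := by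
  refine (distInt_le_abs_sub (x * q) (round x * q)).trans_eq ?_
  have : x * q - ((round x * q : ℤ) : ℝ) = (x - round x) * q := by push_cast; ring
  rw [this, abs_mul, Nat.abs_cast, distInt]

lemma distInt_zero : distInt 0 = 0 := by simp [distInt]

lemma distInt_sum_le {ι : Type*} (s : Finset ι) (f : ι → ℝ) :
    distInt (∑ i ∈ s, f i) ≤ ∑ i ∈ s, distInt (f i) :=
  Finset.le_sum_of_subadditive _ distInt_zero.le distInt_add_le s f

lemma distInt_sub_intCast (x : ℝ) (z : ℤ) : distInt (x - z) = distInt x := by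
  simp [distInt, round_sub_intCast]

lemma distInt_of_abs_le {x : ℝ} (h : |x| ≤ 1 / 2) : distInt x = |x| := by
  refine le_antisymm (distInt_le_abs x) ?_
  rcases eq_or_ne (round x) 0 with h0 | h0
  · simp [distInt, h0]
  · have h1 : (1 : ℝ) ≤ |(round x : ℝ)| := by exact_mod_cast Int.one_le_abs h0
    have h2 := abs_sub_abs_le_abs_sub (round x : ℝ) x
    rw [abs_sub_comm] at h2
    rw [distInt]
    linarith

/-- The quantity `∑ l < m, ‖t Q ^ l‖²`. Up to a factor depending on `Q` it counts the nonzero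
digits among the first `m` digits of `t` in the centred base-`Q` expansion; unlike that count it
is the square of a seminorm-like function, hence behaves well under sums. -/
noncomputable def energy (Q m : ℕ) (t : ℝ) : ℝ :=
  ∑ l ∈ Finset.range m, distInt (t * (Q : ℝ) ^ l) ^ 2

lemma energy_sum_le (Q m : ℕ) {R : ℕ} (t : Fin R → ℝ) {A : ℝ}
    (h : ∀ i, energy Q m (t i) ≤ A) : energy Q m (∑ i, t i) ≤ (R : ℝ) ^ 2 * A := by
  calc energy Q m (∑ i, t i)
      ≤ ∑ l ∈ Finset.range m, (R : ℝ) * ∑ i, distInt (t i * (Q : ℝ) ^ l) ^ 2 := by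
        refine Finset.sum_le_sum fun l _ ↦ ?_
        rw [Finset.sum_mul]
        calc _ ≤ (∑ i, distInt (t i * (Q : ℝ) ^ l)) ^ 2 :=
              pow_le_pow_left₀ (distInt_nonneg _) (distInt_sum_le _ _) 2
          _ ≤ _ := by
              simpa using sq_sum_le_card_mul_sum_sq (s := Finset.univ)
                (f := fun i : Fin R ↦ distInt (t i * (Q : ℝ) ^ l))
    _ = R * ∑ i, energy Q m (t i) := by
        rw [← Finset.mul_sum, Finset.sum_comm]; rfl
    _ ≤ R * ∑ _i : Fin R, A := by gcongr with i; exact h i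
    _ = (R : ℝ) ^ 2 * A := by simp; ring

/-! ### Power means -/

/-- The power mean inequality, in the form used to pass lower bounds for averages to lower bounds
for averages of powers. -/
lemma pow_mul_card_le_sum_pow {ι : Type*} [Fintype ι] (f : ι → ℝ) (hf : ∀ i, 0 ≤ f i)
    {x : ℝ} (hx : 0 ≤ x) (h : x * Fintype.card ι ≤ ∑ i, f i) (p : ℕ) :
    x ^ p * Fintype.card ι ≤ ∑ i, f i ^ p := by
  rcases isEmpty_or_nonempty ι with _ | _
  · simp
  rcases p with _ | p
  · simp
  have hc : (0 : ℝ) < Fintype.card ι := by exact_mod_cast Fintype.card_pos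
  have h1 := pow_sum_div_card_le_sum_pow (s := Finset.univ) (f := f) (fun i _ ↦ hf i) p
  refine le_trans ?_ h1
  rw [Finset.card_univ, le_div_iff₀ (pow_pos hc p)]
  calc x ^ (p + 1) * Fintype.card ι * (Fintype.card ι : ℝ) ^ p
      = (x * Fintype.card ι) ^ (p + 1) := by ring
    _ ≤ _ := pow_le_pow_left₀ (by positivity) h _

/-! ### Weyl differencing -/

lemma sum_fin_succ_arrow {α M : Type*} [Fintype α] [AddCommMonoid M] {d : ℕ}
    (F : (Fin (d + 1) → α) → M) :
    ∑ v, F v = ∑ a : α, ∑ v : Fin d → α, F (Fin.cons a v) := by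
  rw [← Fintype.sum_prod_type', ← (Fin.consEquiv (fun _ ↦ α)).sum_comp]
  rfl

lemma e_add (x y : ℝ) : e (x + y) = e x * e y := by
  simp only [e, ← Complex.exp_add]
  congr 1
  push_cast
  ring

lemma norm_e (x : ℝ) : ‖e x‖ = 1 := by
  rw [e, show (2 * Real.pi * Complex.I * x : ℂ) = ((2 * Real.pi * x : ℝ) : ℂ) * Complex.I by
    push_cast; ring]
  exact Complex.norm_exp_ofReal_mul_I _

lemma conj_e (x : ℝ) : (starRingEnd ℂ) (e x) = e (-x) := by
  rw [e, e, ← Complex.exp_conj]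
  congr 1
  simp [Complex.conj_ofNat]

lemma e_sum {ι : Type*} (s : Finset ι) (f : ι → ℝ) : e (∑ i ∈ s, f i) = ∏ i ∈ s, e (f i) := by
  simp only [e, ← Complex.exp_sum, Complex.ofReal_sum, Finset.mul_sum]

/-- The coefficient of degree `n` of a polynomial of degree at most `n + 1` after a translation. -/
lemma coeff_taylor_of_natDegree_le {p : Polynomial ℝ} {n : ℕ} (hp : p.natDegree ≤ n + 1) (a : ℝ) :
    (Polynomial.taylor a p).coeff n = p.coeff n + (n + 1) * p.coeff (n + 1) * a := by
  have h : Polynomial.hasseDeriv n p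
      = Polynomial.C (p.coeff n) + Polynomial.C ((n + 1) * p.coeff (n + 1)) * Polynomial.X := by
    ext i
    rw [Polynomial.hasseDeriv_coeff]
    rcases i with _ | _ | i
    · simp
    · simp [Polynomial.coeff_C, add_comm 1 n]
    · rw [Polynomial.coeff_eq_zero_of_natDegree_lt (by omega)]
      simp [Polynomial.coeff_one]
  rw [Polynomial.taylor_coeff, h]
  simp

/-- The difference of two translates of a polynomial of degree at most `n + 1`. -/
lemma natDegree_taylor_sub_taylor_le {p : Polynomial ℝ} {n : ℕ} (hp : p.natDegree ≤ n + 1)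
    (a a' : ℝ) : (Polynomial.taylor a p - Polynomial.taylor a' p).natDegree ≤ n := by
  rw [Polynomial.natDegree_le_iff_coeff_eq_zero]
  intro N hN
  have h : ∀ c : ℝ, (Polynomial.taylor c p).coeff N = p.coeff N := by
    intro c
    rw [coeff_taylor_of_natDegree_le (hp.trans (by omega)),
      Polynomial.coeff_eq_zero_of_natDegree_lt (n := N + 1) (by omega)]
    simp
  rw [Polynomial.coeff_sub, h, h, sub_self]

/-- A double sum whose inner sums run over one variable: Cauchy–Schwarz followed by an exchange of
summation. -/
lemma norm_sum_sum_sq_le {Ω T : Type*} [Fintype Ω] [Fintype T] (f : Ω → T → ℝ) :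
    ‖∑ w, ∑ t, e (f w t)‖ ^ 2 ≤
      Fintype.card T * ∑ u : Ω × Ω, ‖∑ t, e (f u.1 t - f u.2 t)‖ := by
  have key : ((∑ t, ‖∑ w, e (f w t)‖ ^ 2 : ℝ) : ℂ)
      = ∑ u : Ω × Ω, ∑ t, e (f u.1 t - f u.2 t) := by
    rw [Finset.sum_comm]
    push_cast
    refine Finset.sum_congr rfl fun t _ ↦ ?_
    rw [← Complex.mul_conj', map_sum, Finset.sum_mul_sum, Fintype.sum_prod_type]
    simp_rw [conj_e, ← e_add, sub_eq_add_neg]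
  calc ‖∑ w, ∑ t, e (f w t)‖ ^ 2 = ‖∑ t, ∑ w, e (f w t)‖ ^ 2 := by rw [Finset.sum_comm]
    _ ≤ (∑ t, ‖∑ w, e (f w t)‖) ^ 2 := pow_le_pow_left₀ (norm_nonneg _) (norm_sum_le _ _) 2
    _ ≤ Fintype.card T * ∑ t, ‖∑ w, e (f w t)‖ ^ 2 := by
        simpa using sq_sum_le_card_mul_sum_sq (s := Finset.univ)
          (f := fun t : T ↦ ‖∑ w, e (f w t)‖)
    _ ≤ _ := by
        gcongr
        calc (∑ t, ‖∑ w, e (f w t)‖ ^ 2 : ℝ)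
            = ‖((∑ t, ‖∑ w, e (f w t)‖ ^ 2 : ℝ) : ℂ)‖ := by
              rw [Complex.norm_real, Real.norm_of_nonneg]
              positivity
          _ ≤ _ := by rw [key]; exact norm_sum_le _ _

/-- Weyl differencing for a polynomial phase of degree at most `d + 1` evaluated at a sum of
`d + 1` independent variables: all variables but the last are differenced, so that the phase
becomes linear in the last one. -/
lemma weyl_differencing {Ω : Type*} [Fintype Ω] [Nonempty Ω] (d : ℕ) :
    ∀ (p : Polynomial ℝ), p.natDegree ≤ d + 1 → ∀ (X : Fin (d + 1) → Ω → ℝ) (δ : ℝ), 0 ≤ δ →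
      δ * (Fintype.card Ω : ℝ) ^ (d + 1) ≤
        ‖∑ ω : Fin (d + 1) → Ω, e (p.eval (∑ j, X j (ω j)))‖ →
      δ ^ 2 ^ d * (Fintype.card Ω : ℝ) ^ (2 * d + 1) ≤
        ∑ v : Fin d → Ω × Ω, ‖∑ w : Ω, e ((d + 1).factorial * p.coeff (d + 1) *
          (∏ j : Fin d, (X j.castSucc (v j).1 - X j.castSucc (v j).2)) * X (Fin.last d) w)‖ := by
  induction d with
  | zero =>
    intro p hp X δ hδ h
    have hev : ∀ s, p.eval s = p.coeff 1 * s + p.coeff 0 := fun s ↦ by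
      rw [Polynomial.eval_eq_sum_range' (n := 2) (by omega)]
      simp [Finset.sum_range_succ, add_comm]
    simp only [hev, e_add, ← Finset.sum_mul, norm_mul, norm_e, mul_one] at h
    rw [sum_fin_succ_arrow] at h
    simpa using h
  | succ d ih =>
    intro p hp X δ hδ h
    set C : ℝ := ((Fintype.card Ω : ℕ) : ℝ) with hC
    have hC0 : 0 < C := by rw [hC]; exact_mod_cast Fintype.card_pos
    let P : Ω × Ω → Polynomial ℝ :=
      fun u ↦ Polynomial.taylor (X 0 u.1) p - Polynomial.taylor (X 0 u.2) p
    let S : (Fin (d + 1) → Ω) → ℝ := fun ω ↦ ∑ j : Fin (d + 1), X j.succ (ω j)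
    let f : Ω × Ω → ℝ := fun u ↦ ‖∑ ω, e ((P u).eval (S ω))‖ / C ^ (d + 1)
    have hf : ∀ u, 0 ≤ f u := fun u ↦ by positivity
    have h1 : δ ^ 2 * Fintype.card (Ω × Ω) ≤ ∑ u, f u := by
      have h2 := norm_sum_sum_sq_le (fun (w : Ω) (ω : Fin (d + 1) → Ω) ↦ p.eval (S ω + X 0 w))
      have h3 : (∑ w, ∑ ω : Fin (d + 1) → Ω, e (p.eval (S ω + X 0 w)))
          = ∑ ω : Fin (d + 2) → Ω, e (p.eval (∑ j, X j (ω j))) := by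
        rw [sum_fin_succ_arrow]
        simp only [S, Fin.sum_univ_succ (n := d + 1), Fin.cons_zero, Fin.cons_succ, add_comm]
      rw [h3] at h2
      have h4 := (pow_le_pow_left₀ (by positivity) h 2).trans h2
      have h5 : ∀ u : Ω × Ω,
          ‖∑ ω : Fin (d + 1) → Ω, e (p.eval (S ω + X 0 u.1) - p.eval (S ω + X 0 u.2))‖
            = f u * C ^ (d + 1) := by
        intro u
        simp only [f, P, Polynomial.eval_sub, Polynomial.taylor_eval]
        field_simp
      simp only [h5, ← Finset.sum_mul] at h4
      have h6 : (Fintype.card (Fin (d + 1) → Ω) : ℝ) = C ^ (d + 1) := by simp [hC]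
      rw [h6] at h4
      have h7 : (Fintype.card (Ω × Ω) : ℝ) = C * C := by simp [hC]
      rw [h7]
      have h8 : 0 < C ^ (d + 1) * C ^ (d + 1) := by positivity
      refine le_of_mul_le_mul_right ?_ h8
      calc _ = (δ * C ^ (d + 1 + 1)) ^ 2 := by ring
        _ ≤ _ := h4
        _ = _ := by ring
    have h2 := pow_mul_card_le_sum_pow f hf (by positivity) h1 (2 ^ d)
    have h3 : ∀ u, f u ^ 2 ^ d * C ^ (2 * d + 1) ≤ _ := fun u ↦
      ih (P u) (natDegree_taylor_sub_taylor_le hp _ _) (fun j ↦ X j.succ) (f u) (hf u) (by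
        simp only [f]
        rw [div_mul_cancel₀ _ (by positivity)])
    calc δ ^ 2 ^ (d + 1) * C ^ (2 * (d + 1) + 1)
        = ((δ ^ 2) ^ 2 ^ d * Fintype.card (Ω × Ω)) * C ^ (2 * d + 1) := by
          simp [hC]; ring
      _ ≤ (∑ u, f u ^ 2 ^ d) * C ^ (2 * d + 1) := by gcongr
      _ = ∑ u, f u ^ 2 ^ d * C ^ (2 * d + 1) := by rw [Finset.sum_mul]
      _ ≤ _ := Finset.sum_le_sum fun u _ ↦ h3 u
      _ = _ := by
        rw [sum_fin_succ_arrow]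
        refine Finset.sum_congr rfl fun u _ ↦ Finset.sum_congr rfl fun v _ ↦ ?_
        congr 1
        refine Finset.sum_congr rfl fun w _ ↦ ?_
        congr 1
        have hc : (P u).coeff (d + 1)
            = (d + 1 + 1) * p.coeff (d + 1 + 1) * (X 0 u.1 - X 0 u.2) := by
          simp only [P, Polynomial.coeff_sub, coeff_taylor_of_natDegree_le hp]
          push_cast
          ring
        rw [hc, Fin.prod_univ_succ, Nat.factorial_succ (d + 1)]
        simp only [Fin.cons_zero, Fin.cons_succ, Fin.castSucc_zero, Fin.succ_castSucc,
          Fin.succ_last]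
        push_cast
        ring

/-! ### Sums over digits and the energy -/

/-- The integer with base-`Q` digits `x 0, x 1, …` (no bound on the digits is required). -/
def digitSum (Q : ℕ) {m : ℕ} (x : Fin m → ℕ) : ℕ := ∑ l, x l * Q ^ (l : ℕ)

lemma norm_one_add_e_sq_le (x : ℝ) : ‖1 + e x‖ ^ 2 ≤ 4 * Real.exp (-4 * distInt x ^ 2) := by
  have h1 : ‖1 + e x‖ ^ 2 = 2 + 2 * Real.cos (2 * Real.pi * x) := by
    obtain ⟨y, hy⟩ : ∃ y : ℝ, y = 2 * Real.pi * x := ⟨_, rfl⟩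
    rw [← hy, e, show (2 * Real.pi * Complex.I * x : ℂ) = (y : ℂ) * Complex.I by
      rw [hy]; push_cast; ring, Complex.exp_mul_I, ← Complex.ofReal_cos, ← Complex.ofReal_sin,
      ← Complex.normSq_eq_norm_sq, Complex.normSq_apply]
    simp [-Complex.ofReal_cos, -Complex.ofReal_sin]
    linear_combination Real.sin_sq_add_cos_sq y
  have h2 : Real.cos (2 * Real.pi * x) = Real.cos (2 * Real.pi * (x - round x)) := by
    rw [← Real.cos_sub_int_mul_two_pi _ (round x)]
    congr 1
    ring
  have hx : |x - round x| ≤ 1 / 2 := abs_sub_round x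
  have hπ := Real.pi_pos
  have h3 : Real.cos (2 * Real.pi * (x - round x)) ≤ 1 - 8 * (x - round x) ^ 2 := by
    refine (Real.cos_le_one_sub_mul_cos_sq ?_).trans_eq (by field_simp; ring)
    rw [abs_mul, abs_of_pos (by positivity)]
    nlinarith
  have h4 := Real.add_one_le_exp (-4 * distInt x ^ 2)
  rw [distInt, sq_abs] at h4 ⊢
  linarith

/-- The Riesz product bound: the exponential sum over integers with digits `0` and `1` factors,
and each factor saves according to the distance of `t * Q ^ l` from the integers. -/
lemma norm_sum_e_digitSum_le (Q m : ℕ) (t : ℝ) :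
    ‖∑ ω : Fin m → Fin 2, e (t * digitSum Q (fun l ↦ (ω l : ℕ)))‖ ≤
      2 ^ m * Real.exp (-2 * energy Q m t) := by
  have h1 : ∑ ω : Fin m → Fin 2, e (t * digitSum Q (fun l ↦ (ω l : ℕ)))
      = ∏ l : Fin m, (1 + e (t * (Q : ℝ) ^ (l : ℕ))) := by
    have h := Finset.prod_univ_sum (fun _ : Fin m ↦ (Finset.univ : Finset (Fin 2)))
      (fun l a ↦ e (t * ((a : ℕ) * (Q : ℝ) ^ (l : ℕ))))
    rw [Fintype.piFinset_univ] at h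
    simp only [digitSum, Nat.cast_sum, Nat.cast_mul, Nat.cast_pow, Finset.mul_sum, e_sum]
    rw [← h]
    refine Finset.prod_congr rfl fun l _ ↦ ?_
    simp [Fin.sum_univ_two, e]
  refine (pow_le_pow_iff_left₀ (norm_nonneg _) (by positivity) two_ne_zero).mp ?_
  rw [h1, norm_prod, ← Finset.prod_pow]
  calc ∏ l : Fin m, ‖1 + e (t * (Q : ℝ) ^ (l : ℕ))‖ ^ 2
      ≤ ∏ l : Fin m, (4 * Real.exp (-4 * distInt (t * (Q : ℝ) ^ (l : ℕ)) ^ 2)) :=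
        Finset.prod_le_prod (fun _ _ ↦ by positivity) fun l _ ↦ norm_one_add_e_sq_le _
    _ = 4 ^ m * Real.exp (-4 * energy Q m t) := by
        rw [Finset.prod_mul_distrib, ← Real.exp_sum, ← Finset.mul_sum, energy,
          Fin.sum_univ_eq_sum_range (fun l ↦ distInt (t * (Q : ℝ) ^ l) ^ 2)]
        simp
    _ = (2 ^ m * Real.exp (-2 * energy Q m t)) ^ 2 := by
        rw [mul_pow, ← Real.exp_nat_mul, ← pow_mul, mul_comm m 2, pow_mul]
        norm_num
        ring

lemma energy_le_of_le_norm_sum {Q m : ℕ} {t κ : ℝ} (hκ : 0 < κ)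
    (h : κ * 2 ^ m ≤ ‖∑ ω : Fin m → Fin 2, e (t * digitSum Q (fun l ↦ (ω l : ℕ)))‖) :
    energy Q m t ≤ Real.log κ⁻¹ / 2 := by
  have h1 := h.trans (norm_sum_e_digitSum_le Q m t)
  rw [mul_comm] at h1
  have h2 := le_of_mul_le_mul_left h1 (by positivity)
  have h3 := Real.log_le_log hκ h2
  rw [Real.log_exp] at h3
  rw [Real.log_inv]
  linarith

/-- A large exponential sum over the `(d + 1)`-st powers of sums of `d + 1` independent integers
with two digits forces small energy of many products of `d` integers with digits `0`, `1`
(up to shifts). -/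
lemma exists_energy_le_of_le_norm_sum {Q m d : ℕ} {θ δ : ℝ} (hδ : 0 < δ) (x₀ x₁ : Fin (d + 1) → ℝ)
    (h : δ * ((2 : ℝ) ^ m) ^ (d + 1) ≤ ‖∑ ω : Fin (d + 1) → Fin m → Fin 2,
      e (θ * (∑ j, (x₀ j + x₁ j * digitSum Q (fun l ↦ (ω j l : ℕ)))) ^ (d + 1))‖) :
    ∃ (s : Fin d → ℝ) (S : Finset (Fin d → Fin m → Fin 2)),
      δ ^ 2 ^ d / 2 * ((2 : ℝ) ^ m) ^ d ≤ S.card ∧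
      ∀ ω ∈ S, energy Q m (θ * (d + 1).factorial * (∏ j, x₁ j) *
        ∏ j, ((digitSum Q (fun l ↦ (ω j l : ℕ)) : ℝ) - s j)) ≤
          Real.log (δ ^ 2 ^ d / 2)⁻¹ / 2 := by
  classical
  set κ : ℝ := δ ^ 2 ^ d / 2 with hκ
  have hκ0 : 0 < κ := by positivity
  let len : (Fin m → Fin 2) → ℝ := fun w ↦ digitSum Q (fun l ↦ (w l : ℕ))
  have hcard : ((Fintype.card (Fin m → Fin 2) : ℕ) : ℝ) = 2 ^ m := by simp
  have h1 := weyl_differencing d (Polynomial.C θ * Polynomial.X ^ (d + 1))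
    (Polynomial.natDegree_C_mul_X_pow_le _ _) (fun j w ↦ x₀ j + x₁ j * len w) δ hδ.le
    (by simpa [len] using h)
  rw [hcard] at h1
  let G : (Fin d → Fin m → Fin 2) → (Fin d → Fin m → Fin 2) → ℝ := fun ω ω' ↦
    ‖∑ w, e ((θ * (d + 1).factorial * (∏ j, x₁ j) * ∏ j, (len (ω j) - len (ω' j))) * len w)‖
  have h2 : δ ^ 2 ^ d * (2 ^ m) ^ (2 * d + 1) ≤ ∑ ω', ∑ ω, G ω ω' := by
    refine h1.trans_eq ?_
    rw [Finset.sum_comm, ← Fintype.sum_prod_type',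
      ← (Equiv.arrowProdEquivProdArrow (Fin d) (fun _ ↦ Fin m → Fin 2)
        (fun _ ↦ Fin m → Fin 2)).sum_comp]
    refine Finset.sum_congr rfl fun v _ ↦ ?_
    have h3 : ∀ w, ((d + 1).factorial * (Polynomial.C θ * Polynomial.X ^ (d + 1)).coeff (d + 1) *
        (∏ j : Fin d, ((x₀ j.castSucc + x₁ j.castSucc * len (v j).1) -
          (x₀ j.castSucc + x₁ j.castSucc * len (v j).2))) *
          (x₀ (Fin.last d) + x₁ (Fin.last d) * len w) : ℝ)
        = (d + 1).factorial * θ * (∏ j : Fin d, x₁ j.castSucc * (len (v j).1 - len (v j).2)) *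
            x₀ (Fin.last d) +
          (θ * (d + 1).factorial * (∏ j, x₁ j) * ∏ j, (len (v j).1 - len (v j).2)) * len w := by
      intro w
      have h4 : ∀ j : Fin d, (x₀ j.castSucc + x₁ j.castSucc * len (v j).1) -
          (x₀ j.castSucc + x₁ j.castSucc * len (v j).2)
          = x₁ j.castSucc * (len (v j).1 - len (v j).2) := fun j ↦ by ring
      simp only [h4, Finset.prod_mul_distrib, Fin.prod_univ_castSucc x₁]
      simp
      ring
    simp only [h3, e_add, ← Finset.mul_sum, norm_mul, norm_e, one_mul, G]
    rfl
  have h5 : ∃ ω', κ * 2 * (2 ^ m) ^ (d + 1) ≤ ∑ ω, G ω ω' := by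
    by_contra! hcon
    have h6 := Finset.sum_lt_sum_of_nonempty (s := Finset.univ) Finset.univ_nonempty
      (fun ω' _ ↦ hcon ω')
    have h7 := h2.trans_lt h6
    simp at h7
    refine absurd h7 (not_lt.mpr (le_of_eq ?_))
    rw [hκ, ← pow_mul]
    ring
  obtain ⟨ω', h6⟩ := h5
  refine ⟨fun j ↦ len (ω' j), Finset.univ.filter fun ω ↦ κ * 2 ^ m ≤ G ω ω', ?_, ?_⟩
  · set S := Finset.univ.filter fun ω ↦ κ * 2 ^ m ≤ G ω ω' with hS
    have h7 : ∀ ω, G ω ω' ≤ (if ω ∈ S then (2 : ℝ) ^ m else 0) + κ * 2 ^ m := by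
      intro ω
      split_ifs with hω
      · have : G ω ω' ≤ 2 ^ m := by
          refine (norm_sum_le _ _).trans_eq ?_
          simp [norm_e]
        have : 0 ≤ κ * 2 ^ m := by positivity
        linarith
      · simp only [hS, Finset.mem_filter, Finset.mem_univ, true_and, not_le] at hω
        linarith
    have h8 := h6.trans (Finset.sum_le_sum fun ω _ ↦ h7 ω)
    rw [Finset.sum_add_distrib, Finset.sum_ite_mem] at h8
    simp at h8
    have h9 : (0 : ℝ) < 2 ^ m := by positivity
    refine le_of_mul_le_mul_right ?_ h9
    rw [pow_succ] at h8
    linarith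
  · intro ω hω
    simp only [Finset.mem_filter, Finset.mem_univ, true_and] at hω
    exact energy_le_of_le_norm_sum hκ0 hω

/-! ### Sumsets of sets of digit vectors -/


section

open Pointwise

/-- The one-dimensional inequality behind `card_mul_card_le_card_add`. -/
lemma sum_mul_add_le_of_forall_le (j : ℕ) {a h : ℕ → ℝ} {b₀ b₁ : ℝ} (hh : ∀ s, 0 ≤ h s)
    (ha : ∀ s, 0 ≤ a s) (hb₀ : 0 ≤ b₀) (hb₁ : 0 ≤ b₁) (h₀ : ∀ s < j, a s * b₀ ≤ h s)
    (h₁ : ∀ s < j, a s * b₁ ≤ h (s + 1)) :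
    (j + 1) * ((∑ s ∈ Finset.range j, a s) * (b₀ + b₁)) ≤
      2 * j * ∑ s ∈ Finset.range (j + 1), h s := by
  set H := ∑ s ∈ Finset.range (j + 1), h s with hH
  have hH0 : 0 ≤ H := Finset.sum_nonneg fun s _ ↦ hh s
  rcases Nat.eq_zero_or_pos j with rfl | hj
  · simp
  let P : ℕ → ℝ := fun t ↦ ∑ s ∈ Finset.range t, a s
  have hP0 : P 0 = 0 := by simp [P]
  have hPj : 0 ≤ P j := Finset.sum_nonneg fun s _ ↦ ha s
  -- Use `h₀` up to the index `t` and `h₁` from `t` on, so that `a t` is used twice.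
  have hV : ∀ t < j, b₀ * P (t + 1) + b₁ * (P j - P t) ≤ H := by
    intro t ht
    have e1 : P j - P t = ∑ s ∈ Finset.Ico t j, a s := by
      rw [Finset.sum_Ico_eq_sub _ ht.le]
    have e2 : H = ∑ s ∈ Finset.range (t + 1), h s + ∑ s ∈ Finset.Ico t j, h (s + 1) := by
      rw [Finset.sum_Ico_add' h t j 1, hH, Finset.sum_range_add_sum_Ico _ (by omega)]
    rw [e1, e2, Finset.mul_sum, Finset.mul_sum]
    refine add_le_add (Finset.sum_le_sum fun s hs ↦ ?_) (Finset.sum_le_sum fun s hs ↦ ?_)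
    · rw [mul_comm]
      exact h₀ s (by have := Finset.mem_range.mp hs; omega)
    · rw [mul_comm]
      exact h₁ s (Finset.mem_Ico.mp hs).2
  -- The weights `w t = b₀ ^ t * b₁ ^ (j - 1 - t)` make the sum over `t` telescope.
  let u : ℕ → ℝ := fun t ↦ b₀ ^ t * b₁ ^ (j - t)
  let w : ℕ → ℝ := fun t ↦ b₀ ^ t * b₁ ^ (j - 1 - t)
  have hw : ∀ t, 0 ≤ w t := fun t ↦ by positivity
  have hu0 : ∀ t < j, w t * b₁ = u t := by
    intro t ht
    simp only [w, u]
    rw [show j - t = j - 1 - t + 1 by omega]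
    ring
  have hu1 : ∀ t < j, w t * b₀ = u (t + 1) := by
    intro t ht
    simp only [w, u]
    rw [show j - (t + 1) = j - 1 - t by omega]
    ring
  set W := ∑ t ∈ Finset.range j, w t with hW
  set U := ∑ t ∈ Finset.range (j + 1), u t with hU
  have hmain : P j * U ≤ W * H := by
    calc P j * U = ∑ t ∈ Finset.range j, w t * (b₀ * P (t + 1) + b₁ * (P j - P t)) := by
          have e3 : ∀ t ∈ Finset.range j, w t * (b₀ * P (t + 1) + b₁ * (P j - P t))
              = (u (t + 1) * P (t + 1) - u t * P t) + P j * u t := by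
            intro t ht
            rw [← hu0 t (Finset.mem_range.mp ht), ← hu1 t (Finset.mem_range.mp ht)]
            ring
          rw [Finset.sum_congr rfl e3, Finset.sum_add_distrib,
            Finset.sum_range_sub (fun t ↦ u t * P t), ← Finset.mul_sum, hP0, hU,
            Finset.sum_range_succ]
          ring
      _ ≤ ∑ t ∈ Finset.range j, w t * H :=
          Finset.sum_le_sum fun t ht ↦
            mul_le_mul_of_nonneg_left (hV t (Finset.mem_range.mp ht)) (hw t)
      _ = W * H := by rw [hW, Finset.sum_mul]
  have hUW : (b₀ + b₁) * W = 2 * U - u 0 - u j := by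
    have e4 : (b₀ + b₁) * W
        = ∑ t ∈ Finset.range j, u (t + 1) + ∑ t ∈ Finset.range j, u t := by
      rw [hW, Finset.mul_sum, ← Finset.sum_add_distrib]
      refine Finset.sum_congr rfl fun t ht ↦ ?_
      rw [← hu0 t (Finset.mem_range.mp ht), ← hu1 t (Finset.mem_range.mp ht)]
      ring
    have e5 : U = ∑ t ∈ Finset.range j, u (t + 1) + u 0 := Finset.sum_range_succ' _ _
    have e6 : U = ∑ t ∈ Finset.range j, u t + u j := Finset.sum_range_succ _ _
    linarith
  have hU2 : 2 * U ≤ (j + 1) * (u 0 + u j) := by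
    have e7 : U = ∑ t ∈ Finset.range (j + 1), u (j - t) := by
      rw [hU, ← Finset.sum_range_reflect]
      simp
    calc 2 * U = ∑ t ∈ Finset.range (j + 1), (u t + u (j - t)) := by
          rw [Finset.sum_add_distrib, ← e7, ← hU]; ring
      _ ≤ ∑ _t ∈ Finset.range (j + 1), (u 0 + u j) := by
          refine Finset.sum_le_sum fun t ht ↦ ?_
          obtain ⟨i, rfl⟩ : ∃ i, j = t + i :=
            Nat.exists_eq_add_of_le (Nat.lt_succ_iff.mp (Finset.mem_range.mp ht))
          have e8 : 0 ≤ (b₀ ^ t - b₁ ^ t) * (b₀ ^ i - b₁ ^ i) := by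
            rcases le_total b₀ b₁ with hb | hb
            · exact mul_nonneg_of_nonpos_of_nonpos
                (sub_nonpos.mpr (pow_le_pow_left₀ hb₀ hb _))
                (sub_nonpos.mpr (pow_le_pow_left₀ hb₀ hb _))
            · exact mul_nonneg (sub_nonneg.mpr (pow_le_pow_left₀ hb₁ hb _))
                (sub_nonneg.mpr (pow_le_pow_left₀ hb₁ hb _))
          simp only [u, Nat.add_sub_cancel_left, Nat.add_sub_cancel, Nat.sub_zero, Nat.sub_self,
            pow_zero, one_mul, mul_one, pow_add]
          nlinarith
      _ = _ := by simp; ring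
  rcases (add_nonneg hb₀ hb₁).eq_or_lt with hb | hb
  · rw [← hb]
    simp only [mul_zero]
    positivity
  have hW0 : 0 < W := by
    refine Finset.sum_pos' (fun t _ ↦ hw t) ?_
    rcases hb₀.eq_or_lt with h0 | h0
    · exact ⟨0, Finset.mem_range.mpr hj, by
        have : 0 < b₁ := by linarith
        simp only [w]; positivity⟩
    · exact ⟨j - 1, Finset.mem_range.mpr (by omega), by
        simp only [w, Nat.sub_self, pow_zero, mul_one]; positivity⟩
  refine le_of_mul_le_mul_right ?_ hW0
  calc (j + 1) * (P j * (b₀ + b₁)) * W = P j * ((j + 1) * ((b₀ + b₁) * W)) := by ring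
    _ ≤ P j * (2 * j * U) := by
        refine mul_le_mul_of_nonneg_left ?_ hPj
        rw [hUW]
        linarith
    _ = 2 * j * (P j * U) := by ring
    _ ≤ 2 * j * (W * H) := by gcongr
    _ = _ := by ring

lemma cons_injective {m : ℕ} (a : ℕ) :
    Function.Injective (fun x : Fin m → ℕ ↦ (Fin.cons a x : Fin (m + 1) → ℕ)) :=
  Fin.cons_right_injective (α := fun _ ↦ ℕ) a

/-- The digit vectors in `A` with first digit `a`, with this digit removed. -/
noncomputable def slice {m : ℕ} (A : Finset (Fin (m + 1) → ℕ)) (a : ℕ) : Finset (Fin m → ℕ) :=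
  A.preimage (fun x ↦ Fin.cons a x) (cons_injective a).injOn

lemma mem_slice {m : ℕ} {A : Finset (Fin (m + 1) → ℕ)} {a : ℕ} {x : Fin m → ℕ} :
    x ∈ slice A a ↔ (Fin.cons a x : Fin (m + 1) → ℕ) ∈ A := Finset.mem_preimage

lemma card_eq_sum_card_slice {m j : ℕ} {A : Finset (Fin (m + 1) → ℕ)} (hA : ∀ x ∈ A, x 0 < j) :
    A.card = ∑ a ∈ Finset.range j, (slice A a).card := by
  rw [Finset.card_eq_sum_card_fiberwise (f := fun x ↦ x 0) (t := Finset.range j)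
    (fun x hx ↦ Finset.mem_coe.mpr (Finset.mem_range.mpr (hA x hx)))]
  refine Finset.sum_congr rfl fun a _ ↦ ?_
  refine Finset.card_nbij' Fin.tail (fun x ↦ Fin.cons a x) ?_ ?_ ?_ ?_
  · rintro x hx
    simp only [Finset.mem_coe, Finset.mem_filter] at hx
    rw [Finset.mem_coe, mem_slice, ← hx.2, Fin.cons_self_tail]
    exact hx.1
  · rintro x hx
    rw [Finset.mem_coe, mem_slice] at hx
    simpa using hx
  · rintro x hx
    simp only [Finset.mem_coe, Finset.mem_filter] at hx
    rw [← hx.2]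
    exact Fin.cons_self_tail x
  · intro x _
    simp

/-- If `A` consists of vectors with digits in `{0, …, j - 1}` and `B` of vectors with digits in
`{0, 1}`, then the density of `A + B` among the vectors with digits in `{0, …, j}` is at least the
product of the densities of `A` and `B`. -/
lemma card_mul_card_le_card_add (j m : ℕ) : ∀ A B : Finset (Fin m → ℕ), (∀ x ∈ A, ∀ l, x l < j) →
    (∀ x ∈ B, ∀ l, x l < 2) →
    (A.card : ℝ) * B.card * (j + 1) ^ m ≤ (A + B).card * (2 * j) ^ m := by
  classical
  induction m with
  | zero =>
    intro A B _ _
    have hA : A.card ≤ 1 := Finset.card_le_one_of_subsingleton A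
    rcases A.eq_empty_or_nonempty with rfl | hA'
    · simp
    · have h2 : (B.card : ℝ) ≤ (A + B).card := by
        exact_mod_cast Finset.card_le_card_add_left hA'
      have h1 : (A.card : ℝ) ≤ 1 := by exact_mod_cast hA
      simp only [pow_zero, mul_one]
      nlinarith [(Nat.cast_nonneg B.card : (0 : ℝ) ≤ B.card)]
  | succ m ih =>
    intro A B hA hB
    have hAB : ∀ x ∈ A + B, x 0 < j + 1 := by
      intro x hx
      obtain ⟨y, hy, z, hz, rfl⟩ := Finset.mem_add.mp hx
      have h1 := hA y hy 0
      have h2 := hB z hz 0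
      simp only [Pi.add_apply]
      omega
    have hsl : ∀ s c, slice A s + slice B c ⊆ slice (A + B) (s + c) := by
      intro s c x hx
      obtain ⟨y, hy, z, hz, rfl⟩ := Finset.mem_add.mp hx
      rw [mem_slice] at hy hz ⊢
      refine Finset.mem_add.mpr ⟨_, hy, _, hz, ?_⟩
      ext i
      refine Fin.cases ?_ (fun i ↦ ?_) i <;> simp
    have hslA : ∀ s, ∀ x ∈ slice A s, ∀ l, x l < j := fun s x hx l ↦ by
      simpa using hA _ (mem_slice.mp hx) l.succ
    have hslB : ∀ s, ∀ x ∈ slice B s, ∀ l, x l < 2 := fun s x hx l ↦ by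
      simpa using hB _ (mem_slice.mp hx) l.succ
    have hcs : ∀ s c, ((slice A s).card : ℝ) * ((slice B c).card * (j + 1) ^ m) ≤
        (slice (A + B) (s + c)).card * (2 * j) ^ m := by
      intro s c
      have h1 := ih _ _ (hslA s) (hslB c)
      have h2 : ((slice A s + slice B c).card : ℝ) ≤ (slice (A + B) (s + c)).card := by
        exact_mod_cast Finset.card_le_card (hsl s c)
      calc _ = ((slice A s).card : ℝ) * (slice B c).card * (j + 1) ^ m := by ring
        _ ≤ _ := h1
        _ ≤ _ := by gcongr
    have key := sum_mul_add_le_of_forall_le j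
      (a := fun s ↦ ((slice A s).card : ℝ))
      (h := fun s ↦ ((slice (A + B) s).card : ℝ) * (2 * j) ^ m)
      (b₀ := (slice B 0).card * (j + 1) ^ m) (b₁ := (slice B 1).card * (j + 1) ^ m)
      (fun s ↦ by positivity) (fun s ↦ by positivity) (by positivity) (by positivity)
      (fun s _ ↦ hcs s 0) (fun s _ ↦ hcs s 1)
    rw [card_eq_sum_card_slice (fun x hx ↦ hA x hx 0),
      card_eq_sum_card_slice (fun x hx ↦ hB x hx 0), card_eq_sum_card_slice hAB]
    rw [← Finset.sum_mul] at key
    simp only [Finset.sum_range_succ (n := 1), Finset.sum_range_one]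
    push_cast
    calc _ = (j + 1) * ((∑ s ∈ Finset.range j, ((slice A s).card : ℝ)) *
          ((slice B 0).card * (j + 1) ^ m + (slice B 1).card * (j + 1) ^ m)) := by ring
      _ ≤ _ := key
      _ = _ := by ring

/-- The `r`-fold sumset of a set of vectors with digits in `{0, 1}` has density at least the `r`-th
power of the density of the set. -/
lemma density_pow_le_card_nsmul {m : ℕ} (A : Finset (Fin m → ℕ)) (hA : ∀ x ∈ A, ∀ l, x l < 2)
    (r : ℕ) : (∀ x ∈ r • A, ∀ l, x l < r + 1) ∧
      ((A.card : ℝ) / 2 ^ m) ^ r * (r + 1) ^ m ≤ (r • A).card := by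
  induction r with
  | zero => simp
  | succ r ih =>
    refine ⟨?_, ?_⟩
    · intro x hx l
      rw [succ_nsmul] at hx
      obtain ⟨y, hy, z, hz, rfl⟩ := Finset.mem_add.mp hx
      have h1 := ih.1 y hy l
      have h2 := hA z hz l
      simp only [Pi.add_apply]
      omega
    · have h := card_mul_card_le_card_add (r + 1) m (r • A) A ih.1 hA
      rw [succ_nsmul]
      have h2 : (0 : ℝ) < (2 * (r + 1)) ^ m := by positivity
      refine le_of_mul_le_mul_right ?_ h2
      push_cast at h ⊢
      refine le_trans ?_ h
      calc _ = (((A.card : ℝ) / 2 ^ m) ^ r * (r + 1) ^ m) * A.card * (r + 1 + 1) ^ m := by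
            rw [mul_pow, pow_succ]
            field_simp
        _ ≤ _ := by gcongr; exact ih.2

lemma digitSum_eq_finFunctionFinEquiv {Q m : ℕ} {x : Fin m → ℕ} (hx : ∀ l, x l < Q) :
    digitSum Q x = finFunctionFinEquiv (fun l ↦ (⟨x l, hx l⟩ : Fin Q)) := by
  rw [finFunctionFinEquiv_apply]
  rfl

lemma digitSum_lt {Q m : ℕ} {x : Fin m → ℕ} (hx : ∀ l, x l < Q) : digitSum Q x < Q ^ m := by
  rw [digitSum_eq_finFunctionFinEquiv hx]
  exact Fin.isLt _

lemma eq_of_digitSum_eq {Q m : ℕ} {x y : Fin m → ℕ} (hx : ∀ l, x l < Q) (hy : ∀ l, y l < Q)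
    (h : digitSum Q x = digitSum Q y) : x = y := by
  rw [digitSum_eq_finFunctionFinEquiv hx, digitSum_eq_finFunctionFinEquiv hy] at h
  have h2 := finFunctionFinEquiv.injective (Fin.ext h)
  funext l
  exact congrArg Fin.val (congrFun h2 l)

lemma digitSum_sum {ι : Type*} (s : Finset ι) (Q : ℕ) {m : ℕ} (x : ι → Fin m → ℕ) :
    digitSum Q (∑ i ∈ s, x i) = ∑ i ∈ s, digitSum Q (x i) := by
  simp only [digitSum, Finset.sum_apply, Finset.sum_mul]
  rw [Finset.sum_comm]

/-- Sums of `Q - 1` integers with base-`Q` digits `0`, `1` taken from a set of density `α` fill a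
proportion at least `α ^ (Q - 1)` of the interval `[0, Q ^ m)`. -/
lemma exists_card_ge_of_sum_digitSum {Q m : ℕ} (hQ : 1 ≤ Q) (S : Finset (Fin m → Fin 2)) :
    ∃ Y : Finset (Fin (Q ^ m)), ((S.card : ℝ) / 2 ^ m) ^ (Q - 1) * (Q : ℝ) ^ m ≤ Y.card ∧
      ∀ y ∈ Y, ∃ f : Fin (Q - 1) → Fin m → Fin 2, (∀ i, f i ∈ S) ∧
        (y : ℕ) = ∑ i, digitSum Q (fun l ↦ (f i l : ℕ)) := by
  classical
  let val : (Fin m → Fin 2) → Fin m → ℕ := fun ω l ↦ (ω l : ℕ)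
  have hval : Function.Injective val := fun ω ω' h ↦
    funext fun l ↦ Fin.ext (congrFun h l)
  have hA : ∀ x ∈ S.image val, ∀ l, x l < 2 := by
    intro x hx l
    obtain ⟨ω, _, rfl⟩ := Finset.mem_image.mp hx
    exact (ω l).isLt
  obtain ⟨h1, h2⟩ := density_pow_le_card_nsmul (S.image val) hA (Q - 1)
  rw [Finset.card_image_of_injective _ hval] at h2
  have hQ1 : ((Q - 1 : ℕ) : ℝ) + 1 = Q := by exact_mod_cast Nat.sub_add_cancel hQ
  rw [hQ1] at h2
  rw [Nat.sub_add_cancel hQ] at h1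
  refine ⟨Finset.univ.filter fun y ↦ (y : ℕ) ∈ ((Q - 1) • S.image val).image (digitSum Q), ?_, ?_⟩
  · refine h2.trans ?_
    rw [← Finset.card_image_of_injOn (f := digitSum Q) (s := (Q - 1) • S.image val)
      (fun x hx y hy hxy ↦ eq_of_digitSum_eq (h1 x hx) (h1 y hy) hxy)]
    rw [← Finset.card_map Fin.valEmbedding]
    refine Nat.cast_le.mpr (Finset.card_le_card ?_)
    intro z hz
    obtain ⟨x, hx, rfl⟩ := Finset.mem_image.mp hz
    exact Finset.mem_map.mpr ⟨⟨_, digitSum_lt (h1 x hx)⟩, by simpa using ⟨x, hx, rfl⟩, rfl⟩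
  · intro y hy
    simp only [Finset.mem_filter, Finset.mem_univ, true_and] at hy
    obtain ⟨x, hx, hxy⟩ := Finset.mem_image.mp hy
    obtain ⟨g, rfl⟩ := Finset.mem_nsmul.mp hx
    have hg : ∀ i, ∃ ω ∈ S, val ω = (g i : Fin m → ℕ) := fun i ↦
      Finset.mem_image.mp (g i).2
    choose f hfS hfg using hg
    refine ⟨f, hfS, ?_⟩
    rw [← hxy, List.sum_ofFn, digitSum_sum]
    exact Finset.sum_congr rfl fun i _ ↦ by rw [← hfg i]

end

/-! ### From digit vectors to all integers -/

/-- Counting a set of `(d + 1)`-tuples by the fibres over the last `d` coordinates. -/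
lemma card_eq_sum_card_fiber {α : Type*} [Fintype α] [DecidableEq α] {d : ℕ}
    (S : Finset (Fin (d + 1) → α)) :
    S.card = ∑ v : Fin d → α,
      (Finset.univ.filter fun a : α ↦ (Fin.cons a v : Fin (d + 1) → α) ∈ S).card := by
  have h : S.card = ∑ ω : Fin (d + 1) → α, if ω ∈ S then 1 else 0 := by simp
  rw [h, sum_fin_succ_arrow, Finset.sum_comm]
  simp only [Finset.card_filter]

/-- Passing from digits `0`, `1` to all digits, one variable at a time. If the energy is small at
the products coming from a set of density `σ` of `d`-tuples of integers with digits `0`, `1`, then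
it is still small at the products coming from a set of density `σ ^ ((Q - 1) ^ d)` of `d`-tuples of
integers in `[0, Q ^ m)`. -/
lemma exists_energy_le_of_digitSum {Q m : ℕ} (hQ : 1 ≤ Q) (d : ℕ) :
    ∀ (c : ℝ) (s : Fin d → ℝ) (S : Finset (Fin d → Fin m → Fin 2)) (σ A : ℝ), 0 ≤ σ →
      σ * ((2 : ℝ) ^ m) ^ d ≤ S.card →
      (∀ ω ∈ S, energy Q m (c * ∏ j, ((digitSum Q (fun l ↦ (ω j l : ℕ)) : ℝ) - s j)) ≤ A) →
      ∃ Z : Finset (Fin d → Fin (Q ^ m)),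
        σ ^ (Q - 1) ^ d * ((Q : ℝ) ^ m) ^ d ≤ Z.card ∧
        ∀ z ∈ Z, energy Q m (c * ∏ j, (((z j : ℕ) : ℝ) - (Q - 1 : ℕ) * s j)) ≤
          (((Q - 1 : ℕ) : ℝ) ^ 2) ^ d * A := by
  classical
  induction d with
  | zero =>
    intro c s S σ A hσ hS hA
    rcases S.eq_empty_or_nonempty with rfl | ⟨ω, hω⟩
    · refine ⟨∅, by simpa using hS, by simp⟩
    · refine ⟨Finset.univ, ?_, fun z _ ↦ by simpa using hA ω hω⟩
      have h1 : S.card ≤ 1 := Finset.card_le_one_of_subsingleton S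
      have h2 : (S.card : ℝ) ≤ 1 := by exact_mod_cast h1
      simp at hS ⊢
      linarith
  | succ d ih =>
    intro c s S σ A hσ hS hA
    have h2m : (0 : ℝ) < 2 ^ m := by positivity
    have hQm : (0 : ℝ) < (Q : ℝ) ^ m := by
      have : (0 : ℝ) < Q := by exact_mod_cast hQ
      positivity
    let len : (Fin m → Fin 2) → ℝ := fun w ↦ digitSum Q (fun l ↦ (w l : ℕ))
    let Sw : (Fin m → Fin 2) → Finset (Fin d → Fin m → Fin 2) := fun w ↦
      Finset.univ.filter fun v ↦ (Fin.cons w v : Fin (d + 1) → Fin m → Fin 2) ∈ S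
    let σw : (Fin m → Fin 2) → ℝ := fun w ↦ (Sw w).card / ((2 : ℝ) ^ m) ^ d
    have hσw : ∀ w, 0 ≤ σw w := fun w ↦ by positivity
    have hScard : (S.card : ℝ) = ∑ w, ((Sw w).card : ℝ) := by
      have h : S.card = ∑ ω : Fin (d + 1) → Fin m → Fin 2, if ω ∈ S then 1 else 0 := by simp
      rw [h, sum_fin_succ_arrow]
      simp only [Sw, Finset.card_filter]
      push_cast
      rfl
    -- The inductive hypothesis for a fixed value `w` of the first variable.
    have hZ : ∀ w, ∃ Z : Finset (Fin d → Fin (Q ^ m)),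
        σw w ^ (Q - 1) ^ d * ((Q : ℝ) ^ m) ^ d ≤ Z.card ∧
        ∀ z ∈ Z, energy Q m (c * (len w - s 0) *
          ∏ j : Fin d, (((z j : ℕ) : ℝ) - (Q - 1 : ℕ) * s j.succ)) ≤
            (((Q - 1 : ℕ) : ℝ) ^ 2) ^ d * A := by
      intro w
      refine ih (c * (len w - s 0)) (fun j ↦ s j.succ) (Sw w) (σw w) A (hσw w) ?_ ?_
      · simp only [σw]
        rw [div_mul_cancel₀ _ (by positivity)]
      · intro v hv
        have h := hA _ (Finset.mem_filter.mp hv).2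
        rw [Fin.prod_univ_succ] at h
        simpa [len, mul_assoc] using h
    choose Z hZcard hZen using hZ
    -- For fixed values of the other variables, sum `Q - 1` values of the first one.
    let U : (Fin d → Fin (Q ^ m)) → Finset (Fin m → Fin 2) := fun z ↦
      Finset.univ.filter fun w ↦ z ∈ Z w
    have hUZ : ∑ z, ((U z).card : ℝ) = ∑ w, ((Z w).card : ℝ) := by
      have h : ∀ w, ((Z w).card : ℝ) = ∑ z, if z ∈ Z w then 1 else 0 := fun w ↦ by simp
      simp only [h, U, Finset.card_filter]
      push_cast
      rw [Finset.sum_comm]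
    choose Y hYcard hYsum using fun z ↦ exists_card_ge_of_sum_digitSum hQ (U z)
    have h1 : σ ^ (Q - 1) ^ d * 2 ^ m ≤ ∑ w, σw w ^ (Q - 1) ^ d := by
      have h := pow_mul_card_le_sum_pow σw hσw hσ (by
        simp only [σw]
        rw [← Finset.sum_div, ← hScard, le_div_iff₀ (by positivity)]
        refine le_trans (le_of_eq ?_) hS
        simp
        ring) ((Q - 1) ^ d)
      simpa using h
    have h2 : (σ ^ (Q - 1) ^ d) ^ (Q - 1) * ((Q : ℝ) ^ m) ^ d ≤
        ∑ z, ((U z).card / (2 : ℝ) ^ m) ^ (Q - 1) := by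
      have h := pow_mul_card_le_sum_pow (fun z ↦ ((U z).card / (2 : ℝ) ^ m))
        (fun z ↦ by positivity) (x := σ ^ (Q - 1) ^ d) (by positivity) (by
          rw [← Finset.sum_div, hUZ, le_div_iff₀ h2m]
          calc _ = (σ ^ (Q - 1) ^ d * 2 ^ m) * ((Q : ℝ) ^ m) ^ d := by simp; ring
            _ ≤ (∑ w, σw w ^ (Q - 1) ^ d) * ((Q : ℝ) ^ m) ^ d := by gcongr
            _ ≤ _ := by
              rw [Finset.sum_mul]
              exact Finset.sum_le_sum fun w _ ↦ hZcard w) (Q - 1)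
      simpa using h
    refine ⟨Finset.univ.filter fun y ↦ y 0 ∈ Y (Fin.tail y), ?_, ?_⟩
    · rw [card_eq_sum_card_fiber]
      simp only [Finset.mem_filter, Finset.mem_univ, true_and, Fin.cons_zero, Fin.tail_cons,
        Finset.filter_mem_eq_inter, Finset.univ_inter]
      push_cast
      calc _ = (σ ^ (Q - 1) ^ d) ^ (Q - 1) * ((Q : ℝ) ^ m) ^ d * (Q : ℝ) ^ m := by
            rw [← pow_mul]; ring
        _ ≤ (∑ z, ((U z).card / (2 : ℝ) ^ m) ^ (Q - 1)) * (Q : ℝ) ^ m := by gcongr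
        _ ≤ _ := by
          rw [Finset.sum_mul]
          exact Finset.sum_le_sum fun z _ ↦ hYcard z
    · intro y hy
      simp only [Finset.mem_filter, Finset.mem_univ, true_and] at hy
      obtain ⟨f, hfU, hf⟩ := hYsum _ _ hy
      have h3 : c * ∏ j, (((y j : ℕ) : ℝ) - (Q - 1 : ℕ) * s j)
          = ∑ i, c * (len (f i) - s 0) *
            ∏ j : Fin d, (((Fin.tail y j : ℕ) : ℝ) - (Q - 1 : ℕ) * s j.succ) := by
        rw [← Finset.sum_mul, ← Finset.mul_sum, Fin.prod_univ_succ, Finset.sum_sub_distrib, hf]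
        simp only [Finset.sum_const, Finset.card_univ, Fintype.card_fin, nsmul_eq_mul, Fin.tail,
          len]
        push_cast
        ring
      rw [h3, pow_succ', mul_assoc]
      exact energy_sum_le Q m _ fun i ↦
        hZen _ _ (Finset.mem_filter.mp (hfU i)).2

/-! ### Clustering of reals with few nonzero digits -/

/-- The pigeonhole principle with a real bound for the number of classes. -/
lemma exists_card_le_mul_card_fiber {α β : Type*} [DecidableEq β] {Z : Finset α} (hZ : Z.Nonempty)
    (f : α → β) {M : ℝ} (hM : ((Z.image f).card : ℝ) ≤ M) :
    ∃ b ∈ Z.image f, (Z.card : ℝ) ≤ M * (Z.filter fun z ↦ f z = b).card := by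
  by_contra! hcon
  have h1 : (Z.card : ℝ) = ∑ b ∈ Z.image f, ((Z.filter fun z ↦ f z = b).card : ℝ) := by
    exact_mod_cast Finset.card_eq_sum_card_image f Z
  have h2 := Finset.sum_lt_sum_of_nonempty (hZ.image f) hcon
  rw [← Finset.mul_sum, ← h1, Finset.sum_const, nsmul_eq_mul] at h2
  have h3 : (0 : ℝ) ≤ Z.card := by positivity
  nlinarith

/-- The number of words of length `K * D` with letters in `{-Q, …, Q}`, at most `D` of them nonzero.
The bound follows on weighting a word by `x` to its number of nonzero letters, for
`x = 1 / (2 * Q * K)`. -/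
lemma card_words_le {Q K D : ℕ} (hQ : 1 ≤ Q) (hK : 1 ≤ K) (E : Finset (Fin (K * D) → ℤ))
    (hE : ∀ f ∈ E, (∀ i, f i ∈ Finset.Icc (-(Q : ℤ)) Q) ∧
      (Finset.univ.filter fun i ↦ f i ≠ 0).card ≤ D) :
    (E.card : ℝ) ≤ (6 * Q * K) ^ D := by
  have hQ' : (1 : ℝ) ≤ Q := by exact_mod_cast hQ
  have hK' : (1 : ℝ) ≤ K := by exact_mod_cast hK
  have hQK : (1 : ℝ) ≤ Q * K := by nlinarith
  set x : ℝ := 1 / (2 * Q * K) with hx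
  have hx0 : 0 < x := by positivity
  have hx1 : x ≤ 1 := by
    rw [hx, div_le_one (by positivity)]
    nlinarith
  let g : ℤ → ℝ := fun a ↦ if a = 0 then 1 else x
  have hg : ∀ a, 0 ≤ g a := fun a ↦ by
    simp only [g]; split_ifs <;> positivity
  have h1 : ∀ f ∈ E, x ^ D ≤ ∏ i, g (f i) := by
    intro f hf
    have h2 : ∏ i, g (f i) = x ^ (Finset.univ.filter fun i ↦ f i ≠ 0).card := by
      simp only [g]
      rw [Finset.prod_ite]
      simp
    rw [h2]
    exact pow_le_pow_of_le_one hx0.le hx1 (hE f hf).2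
  have h3 : ∑ a ∈ Finset.Icc (-(Q : ℤ)) Q, g a = 1 + 1 / K := by
    have h4 : ∀ a, g a = x + if a = 0 then 1 - x else 0 := fun a ↦ by
      simp only [g]; split_ifs <;> ring
    simp only [h4]
    rw [Finset.sum_add_distrib, Finset.sum_ite_eq' _ (0 : ℤ)]
    simp only [Finset.sum_const, Int.card_Icc, Finset.mem_Icc, nsmul_eq_mul]
    rw [if_pos (by constructor <;> omega), show ((Q : ℤ) + 1 - -(Q : ℤ)).toNat = 2 * Q + 1 by omega]
    push_cast
    rw [hx]
    field_simp
    ring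
  have h5 : (E.card : ℝ) * x ^ D ≤ (1 + 1 / K) ^ (K * D) := by
    calc (E.card : ℝ) * x ^ D = ∑ _f ∈ E, x ^ D := by simp
      _ ≤ ∑ f ∈ E, ∏ i, g (f i) := Finset.sum_le_sum h1
      _ ≤ ∑ f ∈ Fintype.piFinset fun _ : Fin (K * D) ↦ Finset.Icc (-(Q : ℤ)) Q, ∏ i, g (f i) :=
          Finset.sum_le_sum_of_subset_of_nonneg
            (fun f hf ↦ Fintype.mem_piFinset.mpr (hE f hf).1)
            fun f _ _ ↦ Finset.prod_nonneg fun i _ ↦ hg _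
      _ = _ := by
          rw [← Finset.prod_univ_sum (fun _ : Fin (K * D) ↦ Finset.Icc (-(Q : ℤ)) Q)
            (fun _ a ↦ g a)]
          simp [h3]
  have h6 : (1 + 1 / (K : ℝ)) ^ (K * D) ≤ 3 ^ D := by
    rw [pow_mul]
    gcongr
    calc (1 + 1 / (K : ℝ)) ^ K ≤ Real.exp (1 / K) ^ K := by
          gcongr
          rw [add_comm]
          exact Real.add_one_le_exp _
      _ = Real.exp 1 := by
          rw [← Real.exp_nat_mul]
          congr 1
          field_simp
      _ ≤ 3 := by linarith [Real.exp_one_lt_d9]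
  have h7 : (6 * (Q : ℝ) * K) ^ D * x ^ D = 3 ^ D := by
    rw [← mul_pow, hx]
    congr 1
    field_simp
    norm_num
  refine le_of_mul_le_mul_right ?_ (pow_pos hx0 D)
  rw [h7]
  exact h5.trans h6

/-- The `i`-th digit of `t` (after the radix point) in the centred base-`Q` expansion. -/
noncomputable def centredDigit (Q : ℕ) (t : ℝ) (i : ℕ) : ℤ :=
  round (Q * (t * (Q : ℝ) ^ i - round (t * (Q : ℝ) ^ i)))

lemma round_mul_pow_succ (Q : ℕ) (t : ℝ) (i : ℕ) :
    round (t * (Q : ℝ) ^ (i + 1)) = Q * round (t * (Q : ℝ) ^ i) + centredDigit Q t i := by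
  rw [centredDigit, ← round_intCast_add]
  congr 1
  push_cast
  ring

lemma centredDigit_mem_Icc {Q : ℕ} (hQ : 1 ≤ Q) (t : ℝ) (i : ℕ) :
    centredDigit Q t i ∈ Finset.Icc (-(Q : ℤ)) Q := by
  have hQ' : (1 : ℝ) ≤ Q := by exact_mod_cast hQ
  set y : ℝ := t * (Q : ℝ) ^ i - round (t * (Q : ℝ) ^ i) with hy
  have h1 : |y| ≤ 1 / 2 := abs_sub_round _
  have h2 : |(Q : ℝ) * y - centredDigit Q t i| ≤ 1 / 2 := abs_sub_round _
  have h3 : |(Q : ℝ) * y| ≤ Q / 2 := by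
    rw [abs_mul, Nat.abs_cast]
    nlinarith
  rw [abs_le] at h2 h3
  rw [Finset.mem_Icc]
  constructor
  · have : (-(Q : ℝ)) ≤ (centredDigit Q t i : ℝ) := by linarith
    exact_mod_cast this
  · have : (centredDigit Q t i : ℝ) ≤ Q := by linarith
    exact_mod_cast this

lemma one_le_distInt_sq_of_centredDigit_ne_zero {Q : ℕ} {t : ℝ} {i : ℕ}
    (h : centredDigit Q t i ≠ 0) : 1 ≤ 4 * (Q : ℝ) ^ 2 * distInt (t * (Q : ℝ) ^ i) ^ 2 := by
  set y : ℝ := t * (Q : ℝ) ^ i - round (t * (Q : ℝ) ^ i) with hy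
  have h1 : 1 / 2 ≤ |(Q : ℝ) * y| := by
    have h2 : (1 : ℝ) ≤ |(centredDigit Q t i : ℝ)| := by exact_mod_cast Int.one_le_abs h
    have h3 : |(Q : ℝ) * y - centredDigit Q t i| ≤ |(Q : ℝ) * y| := by
      have h := round_le ((Q : ℝ) * y) 0
      rwa [Int.cast_zero, sub_zero] at h
    have h4 := abs_sub_abs_le_abs_sub (centredDigit Q t i : ℝ) ((Q : ℝ) * y)
    rw [abs_sub_comm] at h4
    linarith
  have h5 : distInt (t * (Q : ℝ) ^ i) = |y| := rfl
  rw [h5]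
  rw [abs_mul, Nat.abs_cast] at h1
  nlinarith [mul_nonneg (Nat.cast_nonneg Q : (0 : ℝ) ≤ Q) (abs_nonneg y)]

/-- Two reals with the same first `r` centred digits are within `Q ^ (-r)` of each other
modulo one. -/
lemma distInt_sub_le_of_centredDigit_eq {Q r : ℕ} (hQ : 1 ≤ Q) {t t' : ℝ}
    (h : ∀ i < r, centredDigit Q t i = centredDigit Q t' i) :
    distInt (t - t') ≤ ((Q : ℝ) ^ r)⁻¹ := by
  have hQ' : (0 : ℝ) < (Q : ℝ) ^ r := by
    have : (0 : ℝ) < Q := by exact_mod_cast hQ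
    positivity
  let y : ℝ → ℕ → ℝ := fun u i ↦ u * (Q : ℝ) ^ i - round (u * (Q : ℝ) ^ i)
  have h1 : ∀ i ≤ r, y t i - y t' i = (Q : ℝ) ^ i * (y t 0 - y t' 0) := by
    intro i
    induction i with
    | zero => simp
    | succ i ih =>
      intro hi
      have h2 := ih (by omega)
      have h3 : ∀ u, y u (i + 1) = Q * y u i - centredDigit Q u i := fun u ↦ by
        simp only [y]
        rw [round_mul_pow_succ]
        push_cast
        ring
      rw [h3, h3, h i (by omega), pow_succ]
      linear_combination (Q : ℝ) * h2
  have h4 : |y t r - y t' r| ≤ 1 := by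
    have h5 : |y t r| ≤ 1 / 2 := abs_sub_round _
    have h6 : |y t' r| ≤ 1 / 2 := abs_sub_round _
    have h7 := abs_sub (y t r) (y t' r)
    linarith
  rw [h1 r le_rfl, abs_mul, abs_of_pos hQ'] at h4
  have h8 := distInt_le_abs_sub (t - t') (round t - round t')
  have h9 : t - t' - ((round t - round t' : ℤ) : ℝ) = y t 0 - y t' 0 := by
    simp only [y, pow_zero, mul_one]
    push_cast
    ring
  rw [h9] at h8
  refine h8.trans ?_
  rw [← one_div, le_div_iff₀ hQ', mul_comm]
  exact h4

/-- If many reals have small energy over a window of length `r = K * D`, hence few nonzero digits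
there, then a proportion `(6 * Q * K) ^ (-D)` of them lies in an arc of length about `Q ^ (-r)`.
As `K` is at our disposal, the arc can be made much shorter than the proportion. -/
lemma exists_cluster {ι : Type*} {Q K D : ℕ} (hQ : 1 ≤ Q) (hK : 1 ≤ K) {A : ℝ}
    (hD : 4 * (Q : ℝ) ^ 2 * A ≤ D) (Z : Finset ι) (φ : ι → ℝ)
    (hφ : ∀ z ∈ Z, energy Q (K * D) (φ z) ≤ A) :
    ∃ (β : ℝ) (Z' : Finset ι), Z' ⊆ Z ∧ (Z.card : ℝ) ≤ (6 * Q * K) ^ D * Z'.card ∧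
      ∀ z ∈ Z', distInt (φ z - β) ≤ ((Q : ℝ) ^ (K * D))⁻¹ := by
  classical
  rcases Z.eq_empty_or_nonempty with rfl | hZ
  · exact ⟨0, ∅, by simp⟩
  let label : ι → Fin (K * D) → ℤ := fun z i ↦ centredDigit Q (φ z) i
  have hE : ((Z.image label).card : ℝ) ≤ (6 * Q * K) ^ D := by
    refine card_words_le hQ hK _ ?_
    intro f hf
    obtain ⟨z, hz, rfl⟩ := Finset.mem_image.mp hf
    refine ⟨fun i ↦ centredDigit_mem_Icc hQ _ _, ?_⟩
    have h1 : ((Finset.univ.filter fun i ↦ label z i ≠ 0).card : ℝ) ≤ D := by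
      calc ((Finset.univ.filter fun i ↦ label z i ≠ 0).card : ℝ)
          = ∑ _i ∈ Finset.univ.filter fun i ↦ label z i ≠ 0, (1 : ℝ) := by simp
        _ ≤ ∑ i ∈ Finset.univ.filter fun i ↦ label z i ≠ 0,
              4 * (Q : ℝ) ^ 2 * distInt (φ z * (Q : ℝ) ^ (i : ℕ)) ^ 2 :=
            Finset.sum_le_sum fun i hi ↦
              one_le_distInt_sq_of_centredDigit_ne_zero (Finset.mem_filter.mp hi).2
        _ ≤ ∑ i : Fin (K * D), 4 * (Q : ℝ) ^ 2 * distInt (φ z * (Q : ℝ) ^ (i : ℕ)) ^ 2 :=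
            Finset.sum_le_sum_of_subset_of_nonneg (Finset.subset_univ _)
              fun i _ _ ↦ by positivity
        _ = 4 * (Q : ℝ) ^ 2 * energy Q (K * D) (φ z) := by
            rw [← Finset.mul_sum, energy,
              Fin.sum_univ_eq_sum_range (fun l ↦ distInt (φ z * (Q : ℝ) ^ l) ^ 2)]
        _ ≤ 4 * (Q : ℝ) ^ 2 * A := by gcongr; exact hφ z hz
        _ ≤ D := hD
    exact_mod_cast h1
  obtain ⟨b, hb, hcard⟩ := exists_card_le_mul_card_fiber hZ label hE
  obtain ⟨z₀, hz₀, rfl⟩ := Finset.mem_image.mp hb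
  refine ⟨φ z₀, Z.filter fun z ↦ label z = label z₀, Finset.filter_subset _ _, hcard, ?_⟩
  intro z hz
  refine distInt_sub_le_of_centredDigit_eq hQ fun i hi ↦ ?_
  exact congrFun (Finset.mem_filter.mp hz).2 ⟨i, hi⟩

/-! ### Linear and multilinear recurrence -/

lemma card_le_of_forall_sub_le {S : Finset ℤ} {ℓ : ℝ} (hℓ : 0 ≤ ℓ)
    (h : ∀ a ∈ S, ∀ b ∈ S, (a : ℝ) - b ≤ ℓ) : (S.card : ℝ) ≤ ℓ + 1 := by
  rcases S.eq_empty_or_nonempty with rfl | hS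
  · simp; linarith
  have h1 : S ⊆ Finset.Icc (S.min' hS) (S.max' hS) := fun a ha ↦
    Finset.mem_Icc.mpr ⟨S.min'_le a ha, S.le_max' a ha⟩
  have h2 := h _ (S.max'_mem hS) _ (S.min'_mem hS)
  have h3 : S.min' hS ≤ S.max' hS := S.min'_le _ (S.max'_mem hS)
  have h4 : (S.card : ℤ) ≤ S.max' hS + 1 - S.min' hS := by
    have h5 := Finset.card_le_card h1
    rw [Int.card_Icc] at h5
    omega
  have h6 : (S.card : ℝ) ≤ S.max' hS + 1 - S.min' hS := by exact_mod_cast h4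
  linarith

/-- The number of `l < x` for which `l * β + γ` is within `η` of an integer: the first factor
counts the integers that are approached, the second factor the `l` that approach a given one. -/
lemma card_distInt_le {L : Finset ℕ} {x β γ η : ℝ} (hL : ∀ l ∈ L, (l : ℝ) ≤ x) (hx : 0 ≤ x)
    (hβ : β ≠ 0) (hη : 0 ≤ η) (h : ∀ l ∈ L, distInt (l * β + γ) ≤ η) :
    (L.card : ℝ) ≤ (x * |β| + 2 * η + 1) * (2 * η / |β| + 1) := by
  classical
  have hβ' : 0 < |β| := abs_pos.mpr hβ
  let f : ℕ → ℤ := fun l ↦ round (l * β + γ)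
  have hf : ∀ l ∈ L, |l * β + γ - f l| ≤ η := h
  have himg : ((L.image f).card : ℝ) ≤ x * |β| + 2 * η + 1 := by
    refine card_le_of_forall_sub_le (by positivity) ?_
    intro a ha b hb
    obtain ⟨l, hl, rfl⟩ := Finset.mem_image.mp ha
    obtain ⟨l', hl', rfl⟩ := Finset.mem_image.mp hb
    have h1 := abs_le.mp (hf l hl)
    have h2 := abs_le.mp (hf l' hl')
    have h3 : ((l : ℝ) - l') * β ≤ x * |β| := by
      refine (le_abs_self _).trans ?_
      rw [abs_mul]
      refine mul_le_mul_of_nonneg_right ?_ hβ'.le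
      have h4 := hL l hl
      have h5 := hL l' hl'
      have h6 : (0 : ℝ) ≤ l := Nat.cast_nonneg l
      have h7 : (0 : ℝ) ≤ l' := Nat.cast_nonneg l'
      rw [abs_le]
      constructor <;> linarith
    linarith
  have hfib : ∀ b ∈ L.image f, ((L.filter fun l ↦ f l = b).card : ℝ) ≤ 2 * η / |β| + 1 := by
    intro b _
    rw [← Finset.card_map (Nat.castEmbedding : ℕ ↪ ℤ)]
    refine card_le_of_forall_sub_le (by positivity) ?_
    intro a ha a' ha'
    obtain ⟨l, hl, rfl⟩ := Finset.mem_map.mp ha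
    obtain ⟨l', hl', rfl⟩ := Finset.mem_map.mp ha'
    rw [Finset.mem_filter] at hl hl'
    have h1 := hf l hl.1
    have h2 := hf l' hl'.1
    rw [hl.2] at h1
    rw [hl'.2] at h2
    rw [le_div_iff₀ hβ']
    have h3 : |((l : ℝ) - l') * β| ≤ 2 * η := by
      have h4 : ((l : ℝ) - l') * β = (l * β + γ - b) - (l' * β + γ - b) := by ring
      rw [h4]
      exact (abs_sub _ _).trans (by linarith)
    rw [abs_mul] at h3
    refine le_trans ?_ h3
    refine mul_le_mul_of_nonneg_right ?_ hβ'.le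
    simpa using le_abs_self ((l : ℝ) - l')
  have h1 : (L.card : ℝ) = ∑ b ∈ L.image f, ((L.filter fun l ↦ f l = b).card : ℝ) := by
    exact_mod_cast Finset.card_eq_sum_card_image f L
  rw [h1]
  refine (Finset.sum_le_sum hfib).trans ?_
  rw [Finset.sum_const, nsmul_eq_mul]
  exact mul_le_mul_of_nonneg_right himg (by positivity)

/-- Vinogradov's lemma: if `α * z` lies in a fixed short arc for a positive proportion `4 / τ` of
the integers `z < N`, then `α` is close to a rational with denominator at most `τ / 2`. -/
lemma exists_distInt_mul_le {N : ℕ} {α β η τ : ℝ} (hτ : 8 ≤ τ) (hη : 0 ≤ η)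
    (hητ : 4 * η * τ ≤ 1) (hN : τ ^ 2 ≤ N) (Z : Finset (Fin N)) (hZ : 4 * N ≤ τ * Z.card)
    (h : ∀ z ∈ Z, distInt (α * (z : ℕ) - β) ≤ η) :
    ∃ q : ℕ, 0 < q ∧ (q : ℝ) ≤ τ / 2 ∧ distInt (α * q) ≤ 4 * η * τ * q / N := by
  classical
  have hN0 : (0 : ℝ) < N := by nlinarith
  have hZ0 : Z.Nonempty := by
    rw [Finset.nonempty_iff_ne_empty]
    rintro rfl
    simp at hZ
    linarith
  -- Two elements of `Z` lie in the same block of length `H`.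
  set H : ℕ := ⌊τ / 2⌋₊ with hH
  have hH1 : (H : ℝ) ≤ τ / 2 := Nat.floor_le (by linarith)
  have hH2 : τ / 2 < H + 1 := Nat.lt_floor_add_one _
  have hH3 : 3 * τ / 8 ≤ H := by linarith
  have hH0 : 0 < H := by
    have : (0 : ℝ) < H := by linarith
    exact_mod_cast this
  obtain ⟨q, hq0, hqH, hq2⟩ : ∃ q : ℕ, 0 < q ∧ q ≤ H ∧ distInt (α * q) ≤ 2 * η := by
    have h1 : (Finset.range (N / H + 1)).card < Z.card := by
      rw [Finset.card_range]
      have h2 : ((N / H : ℕ) : ℝ) ≤ N / H := Nat.cast_div_le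
      have h3 : (N : ℝ) / H ≤ 8 * N / (3 * τ) := by
        rw [div_le_div_iff₀ (by exact_mod_cast hH0) (by linarith)]
        nlinarith
      have h4 : 4 * N / τ ≤ Z.card := by
        rw [div_le_iff₀ (by linarith)]
        linarith
      have h5 : 8 * N / (3 * τ) + 1 < 4 * N / τ := by
        rw [← sub_pos]
        have h6 : 4 * N / τ - (8 * N / (3 * τ) + 1) = (4 * N - 3 * τ) / (3 * τ) := by
          field_simp
          ring
        rw [h6]
        apply div_pos <;> nlinarith
      have h6 : ((N / H + 1 : ℕ) : ℝ) < Z.card := by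
        push_cast at h2 ⊢
        linarith
      exact_mod_cast h6
    obtain ⟨y, hy, z, hz, hyz, hdiv⟩ := Finset.exists_ne_map_eq_of_card_lt_of_maps_to h1
      (f := fun z : Fin N ↦ (z : ℕ) / H) (fun z _ ↦ Finset.mem_coe.mpr (Finset.mem_range.mpr
        (Nat.lt_succ_of_le (Nat.div_le_div_right z.isLt.le))))
    wlog hlt : (y : ℕ) < z generalizing y z
    · refine this z hz y hy hyz.symm hdiv.symm ?_
      have : (y : ℕ) ≠ z := fun h ↦ hyz (Fin.ext h)
      omega
    refine ⟨z - y, by omega, ?_, ?_⟩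
    · have hdiv : (y : ℕ) / H = (z : ℕ) / H := hdiv
      have h2 := Nat.div_add_mod (y : ℕ) H
      have h3 := Nat.div_add_mod (z : ℕ) H
      rw [hdiv] at h2
      have h4 := Nat.mod_lt (z : ℕ) hH0
      omega
    · have h2 : α * ((z - y : ℕ) : ℝ) = (α * (z : ℕ) - β) - (α * (y : ℕ) - β) := by
        rw [Nat.cast_sub hlt.le]
        ring
      rw [h2]
      have h3 := distInt_sub_le (α * (z : ℕ) - β) (α * (y : ℕ) - β)
      linarith [h z hz, h y hy]
  have hq0' : (0 : ℝ) < q := by exact_mod_cast hq0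
  have hqτ : (q : ℝ) ≤ τ / 2 := le_trans (by exact_mod_cast hqH) hH1
  refine ⟨q, hq0, hqτ, ?_⟩
  set b : ℝ := α * q - round (α * q) with hb
  have hbq : distInt (α * q) = |b| := rfl
  rw [hbq] at hq2 ⊢
  rcases eq_or_ne b 0 with hb0 | hb0
  · rw [hb0, abs_zero]
    have : 0 ≤ τ := by linarith
    positivity
  have hb' : 0 < |b| := abs_pos.mpr hb0
  -- Count `Z` in each residue class modulo `q`.
  let L : ℕ → Finset ℕ := fun ρ ↦ (Z.filter fun z : Fin N ↦ (z : ℕ) % q = ρ).image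
    fun z : Fin N ↦ (z : ℕ) / q
  have hL : ∀ ρ, ((L ρ).card : ℝ) ≤ (N / q * |b| + 2 * η + 1) * (2 * η / |b| + 1) := by
    intro ρ
    refine card_distInt_le (γ := α * ρ - β) ?_ (by positivity) hb0 hη ?_
    · intro l hl
      obtain ⟨z, _, rfl⟩ := Finset.mem_image.mp hl
      refine Nat.cast_div_le.trans ?_
      gcongr
      exact z.isLt.le
    · intro l hl
      obtain ⟨z, hz, rfl⟩ := Finset.mem_image.mp hl
      obtain ⟨hzZ, hzρ⟩ := Finset.mem_filter.mp hz
      have h1 : ((z : ℕ) : ℝ) = q * ((z : ℕ) / q : ℕ) + ρ := by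
        rw [← hzρ]
        exact_mod_cast (Nat.div_add_mod (z : ℕ) q).symm
      have h2 : (((z : ℕ) / q : ℕ) : ℝ) * b + (α * ρ - β)
          = (α * (z : ℕ) - β) - ((round (α * q) * ((z : ℕ) / q : ℕ) : ℤ) : ℝ) := by
        rw [h1, hb]
        generalize (z : ℕ) / q = l
        push_cast
        ring
      rw [h2, distInt_sub_intCast]
      exact h z hzZ
  have hcard : (Z.card : ℝ) ≤ q * ((N / q * |b| + 2 * η + 1) * (2 * η / |b| + 1)) := by
    have h1 : Z.card = ∑ ρ ∈ Finset.range q, (Z.filter fun z : Fin N ↦ (z : ℕ) % q = ρ).card :=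
      Finset.card_eq_sum_card_fiberwise fun z _ ↦
        Finset.mem_coe.mpr (Finset.mem_range.mpr (Nat.mod_lt _ hq0))
    have h2 : ∀ ρ, (Z.filter fun z : Fin N ↦ (z : ℕ) % q = ρ).card = (L ρ).card := by
      intro ρ
      refine (Finset.card_image_of_injOn ?_).symm
      intro y hy z hz hyz
      simp only [Finset.mem_coe, Finset.mem_filter] at hy hz hyz
      refine Fin.ext ?_
      rw [← Nat.div_add_mod (y : ℕ) q, ← Nat.div_add_mod (z : ℕ) q, hyz, hy.2, hz.2]
    rw [h1]
    push_cast
    calc _ ≤ ∑ _ρ ∈ Finset.range q, ((N / q * |b| + 2 * η + 1) * (2 * η / |b| + 1) : ℝ) :=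
          Finset.sum_le_sum fun ρ _ ↦ by rw [h2]; exact hL ρ
      _ = _ := by simp
  -- As `|b| ≤ 2 η`, the second factor is at most `4 η / |b|`.
  have h1 : 2 * η / |b| + 1 ≤ 4 * η / |b| := by
    have : 1 ≤ 2 * η / |b| := by rwa [le_div_iff₀ hb', one_mul]
    have h2 : 4 * η / |b| = 2 * η / |b| + 2 * η / |b| := by ring
    linarith
  have h2 : 2 * η + 1 ≤ 2 := by nlinarith
  have h3 : (Z.card : ℝ) ≤ 4 * η * N + 8 * η * q / |b| := by
    calc (Z.card : ℝ) ≤ q * ((N / q * |b| + 2) * (4 * η / |b|)) := by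
          refine hcard.trans (mul_le_mul_of_nonneg_left ?_ hq0'.le)
          exact mul_le_mul (by linarith) h1 (by positivity) (by positivity)
      _ = _ := by
          field_simp
          ring
  have h4 : 2 * N * |b| ≤ 8 * η * q * τ := by
    have h5 : 4 * N ≤ N + τ * (8 * η * q / |b|) := by
      nlinarith
    have h6 : 2 * N ≤ τ * (8 * η * q / |b|) := by linarith
    calc 2 * N * |b| ≤ τ * (8 * η * q / |b|) * |b| := by gcongr
      _ = _ := by field_simp
  rw [le_div_iff₀ hN0]
  linarith

/-- One step of the multilinear version of Vinogradov's lemma, removing one variable. -/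
lemma exists_remove_variable {N d : ℕ} {c β η τ : ℝ} (s : Fin (d + 1) → ℝ) (hτ : 8 ≤ τ)
    (hη : 0 ≤ η) (hητ : 4 * η * τ ≤ 1) (hN : τ ^ 2 ≤ N) (Z : Finset (Fin (d + 1) → Fin N))
    (hZ : 8 * (N : ℝ) ^ (d + 1) ≤ τ * Z.card)
    (h : ∀ z ∈ Z, distInt (c * ∏ j, (((z j : ℕ) : ℝ) - s j) - β) ≤ η) :
    ∃ q : ℕ, 0 < q ∧ (q : ℝ) ≤ τ ∧ ∃ Z' : Finset (Fin d → Fin N),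
      8 * (N : ℝ) ^ d ≤ τ ^ 2 * Z'.card ∧
      ∀ z ∈ Z', distInt (c * q * ∏ j : Fin d, (((z j : ℕ) : ℝ) - s j.succ) - 0) ≤
        2 * η * τ ^ 2 / N := by
  classical
  have hN0 : (0 : ℝ) < N := by nlinarith
  have hτ0 : 0 < τ := by linarith
  let F : (Fin d → Fin N) → Finset (Fin N) := fun v ↦
    Finset.univ.filter fun a ↦ (Fin.cons a v : Fin (d + 1) → Fin N) ∈ Z
  let G : Finset (Fin d → Fin N) := Finset.univ.filter fun v ↦ 4 * (N : ℝ) ≤ τ * (F v).card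
  -- Many `d`-tuples have a large fibre.
  have hG : 4 * (N : ℝ) ^ d ≤ τ * G.card := by
    have h1 : ∀ v, τ * ((F v).card : ℝ) ≤ (if v ∈ G then τ * (N : ℝ) else 0) + 4 * N := by
      intro v
      split_ifs with hv
      · have h2 : ((F v).card : ℝ) ≤ N := by
          exact_mod_cast (Finset.card_le_univ _).trans_eq (Fintype.card_fin N)
        nlinarith
      · simp only [G, Finset.mem_filter, Finset.mem_univ, true_and, not_le] at hv
        linarith
    have h2 : (Z.card : ℝ) = ∑ v, ((F v).card : ℝ) := by
      exact_mod_cast card_eq_sum_card_fiber Z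
    have h3 := Finset.sum_le_sum fun v (_ : v ∈ Finset.univ) ↦ h1 v
    rw [← Finset.mul_sum, ← h2, Finset.sum_add_distrib, Finset.sum_ite_mem] at h3
    simp at h3
    have h4 := hZ.trans h3
    refine le_of_mul_le_mul_right ?_ hN0
    rw [pow_succ] at h4
    linarith
  have hGne : G.Nonempty := by
    rw [Finset.nonempty_iff_ne_empty]
    intro h0
    rw [h0] at hG
    have : (0 : ℝ) < (N : ℝ) ^ d := by positivity
    simp at hG
    linarith
  have hq : ∀ v, ∃ q : ℕ, v ∈ G → 0 < q ∧ (q : ℝ) ≤ τ / 2 ∧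
      distInt (c * (∏ j : Fin d, (((v j : ℕ) : ℝ) - s j.succ)) * q) ≤ 4 * η * τ * q / N := by
    intro v
    by_cases hv : v ∈ G
    · obtain ⟨q, hq⟩ := exists_distInt_mul_le
        (α := c * (∏ j : Fin d, (((v j : ℕ) : ℝ) - s j.succ)))
        (β := c * (∏ j : Fin d, (((v j : ℕ) : ℝ) - s j.succ)) * s 0 + β) hτ hη hητ hN (F v)
        (Finset.mem_filter.mp hv).2 (by
          intro z hz
          have h1 := h _ (Finset.mem_filter.mp hz).2
          rw [Fin.prod_univ_succ] at h1
          simp only [Fin.cons_zero, Fin.cons_succ] at h1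
          refine le_trans (le_of_eq ?_) h1
          congr 1
          ring)
      exact ⟨q, fun _ ↦ hq⟩
    · exact ⟨0, fun h ↦ absurd h hv⟩
  choose q hq using hq
  -- A popular value of `q`.
  have himg : ((G.image q).card : ℝ) ≤ τ / 2 := by
    have h1 : G.image q ⊆ Finset.Icc 1 ⌊τ / 2⌋₊ := by
      intro a ha
      obtain ⟨v, hv, rfl⟩ := Finset.mem_image.mp ha
      exact Finset.mem_Icc.mpr ⟨(hq v hv).1, Nat.le_floor (hq v hv).2.1⟩
    have h2 := Finset.card_le_card h1
    rw [Nat.card_Icc, Nat.add_sub_cancel] at h2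
    exact le_trans (by exact_mod_cast h2) (Nat.floor_le (by linarith))
  obtain ⟨b, hb, hcard⟩ := exists_card_le_mul_card_fiber hGne q himg
  obtain ⟨v₀, hv₀, rfl⟩ := Finset.mem_image.mp hb
  refine ⟨q v₀, (hq v₀ hv₀).1, (hq v₀ hv₀).2.1.trans (by linarith),
    G.filter fun v ↦ q v = q v₀, ?_, ?_⟩
  · nlinarith
  · intro v hv
    obtain ⟨hvG, hvq⟩ := Finset.mem_filter.mp hv
    obtain ⟨_, h2, h3⟩ := hq v hvG
    rw [hvq] at h2 h3
    rw [sub_zero, mul_right_comm]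
    refine h3.trans ?_
    gcongr ?_ / _
    calc 4 * η * τ * q v₀ ≤ 4 * η * τ * (τ / 2) := by gcongr
      _ = 2 * η * τ ^ 2 := by ring

/-- The multilinear version of Vinogradov's lemma. -/
lemma exists_distInt_mul_le_of_prod {N : ℕ} (d : ℕ) : ∀ (c β η τ : ℝ) (s : Fin (d + 1) → ℝ),
    8 ≤ τ → 0 ≤ η → 4 * η * τ ≤ 1 → τ ^ (3 * 2 ^ (d + 1)) ≤ N →
    ∀ Z : Finset (Fin (d + 1) → Fin N), 8 * (N : ℝ) ^ (d + 1) ≤ τ * Z.card →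
    (∀ z ∈ Z, distInt (c * ∏ j, (((z j : ℕ) : ℝ) - s j) - β) ≤ η) →
    ∃ q : ℕ, 0 < q ∧ (q : ℝ) ≤ τ ^ (2 ^ (d + 1) - 1) ∧
      distInt (c * q) ≤ η * τ ^ (3 * (2 ^ (d + 1) - 1)) / (N : ℝ) ^ (d + 1) := by
  induction d with
  | zero =>
    intro c β η τ s hτ hη hητ hN Z hZ h
    have hτ1 : 1 ≤ τ := by linarith
    have hN0 : (0 : ℝ) < N := lt_of_lt_of_le (by positivity) hN
    obtain ⟨q, hq0, hq1, Z', hZ', h'⟩ := exists_remove_variable s hτ hη hητ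
      ((pow_le_pow_right₀ hτ1 (by norm_num)).trans hN) Z hZ h
    have hne : Z'.Nonempty := by
      rw [Finset.nonempty_iff_ne_empty]
      rintro rfl
      simp at hZ'
      linarith
    obtain ⟨z, hz⟩ := hne
    have h1 := h' z hz
    simp only [Finset.univ_eq_empty, Finset.prod_empty, mul_one, sub_zero] at h1
    refine ⟨q, hq0, by simpa using hq1, h1.trans ?_⟩
    calc 2 * η * τ ^ 2 / N = 2 * (η * τ ^ 2) / N := by ring
      _ ≤ τ * (η * τ ^ 2) / N := by gcongr; linarith
      _ = _ := by norm_num; ring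
  | succ d ih =>
    intro c β η τ s hτ hη hητ hN Z hZ h
    have hτ1 : 1 ≤ τ := by linarith
    have hN0 : (0 : ℝ) < N := lt_of_lt_of_le (by positivity) hN
    have h2d : 1 ≤ 2 ^ (d + 1) := Nat.one_le_two_pow
    obtain ⟨q, hq0, hq1, Z', hZ', h'⟩ := exists_remove_variable s hτ hη hητ
      ((pow_le_pow_right₀ hτ1 (by rw [pow_succ]; omega)).trans hN) Z hZ h
    have hN6 : τ ^ 6 ≤ N := (pow_le_pow_right₀ hτ1 (by rw [pow_succ]; omega)).trans hN
    obtain ⟨q', hq'0, hq'1, h''⟩ := ih (c * q) 0 (2 * η * τ ^ 2 / N) (τ ^ 2) (fun j ↦ s j.succ)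
      (by nlinarith) (by positivity) (by
        have h1 : 4 * (2 * η * τ ^ 2 / N) * τ ^ 2 = (4 * η * τ) * (2 * τ ^ 3) / N := by ring
        rw [h1, div_le_one hN0]
        have h2 : 2 ≤ τ ^ 3 := by
          have := pow_le_pow_right₀ hτ1 (show 1 ≤ 3 by norm_num)
          linarith
        calc (4 * η * τ) * (2 * τ ^ 3) ≤ 1 * (τ ^ 3 * τ ^ 3) := by gcongr
          _ = τ ^ 6 := by ring
          _ ≤ N := hN6)
      (by rw [← pow_mul]; refine le_trans (le_of_eq ?_) hN; congr 1; ring)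
      Z' hZ' h'
    refine ⟨q * q', Nat.mul_pos hq0 hq'0, ?_, ?_⟩
    · rw [← pow_mul] at hq'1
      push_cast
      calc (q : ℝ) * q' ≤ τ * τ ^ (2 * (2 ^ (d + 1) - 1)) := by gcongr
        _ = τ ^ (2 * (2 ^ (d + 1) - 1) + 1) := by ring
        _ = _ := by congr 1; rw [pow_succ 2 (d + 1)]; omega
    · push_cast
      rw [← mul_assoc]
      refine h''.trans ?_
      rw [← pow_mul]
      calc 2 * η * τ ^ 2 / N * τ ^ (2 * (3 * (2 ^ (d + 1) - 1))) / (N : ℝ) ^ (d + 1)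
          = 2 * (η * τ ^ (2 * (3 * (2 ^ (d + 1) - 1)) + 2)) / (N : ℝ) ^ (d + 1 + 1) := by
            rw [pow_add τ, pow_succ (N : ℝ) (d + 1)]
            field_simp
        _ ≤ τ * (η * τ ^ (2 * (3 * (2 ^ (d + 1) - 1)) + 2)) / (N : ℝ) ^ (d + 1 + 1) := by
            gcongr
            linarith
        _ = η * τ ^ (2 * (3 * (2 ^ (d + 1) - 1)) + 3) / (N : ℝ) ^ (d + 1 + 1) := by ring
        _ = _ := by
            congr 3
            rw [pow_succ 2 (d + 1)]
            omega

/-! ### Diophantine approximation from small energy -/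

/-- The approximation obtained from the window formed by the digits `i₀, …, i₀ + K * D - 1`: the
products are clustered according to these digits, and the multilinear Vinogradov lemma is applied
to a cluster. -/
lemma exists_distInt_le_of_window {Q m d K D i₀ : ℕ} {c A τ : ℝ} (hQ : 1 ≤ Q) (hK : 1 ≤ K)
    (hD : 4 * (Q : ℝ) ^ 2 * A ≤ D) (hi₀ : i₀ + K * D ≤ m) (s : Fin (d + 1) → ℝ)
    (Z : Finset (Fin (d + 1) → Fin (Q ^ m)))
    (hA : ∀ z ∈ Z, energy Q m (c * ∏ j, (((z j : ℕ) : ℝ) - s j)) ≤ A) (hτ : 8 ≤ τ)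
    (hZ : 8 * ((6 * Q * K) ^ D * ((Q : ℝ) ^ m) ^ (d + 1)) ≤ τ * Z.card)
    (hτ' : 4 * ((Q : ℝ) ^ (K * D))⁻¹ * τ ≤ 1) (hN : τ ^ (3 * 2 ^ (d + 1)) ≤ (Q : ℝ) ^ m) :
    ∃ q : ℕ, 0 < q ∧ (q : ℝ) ≤ τ ^ (2 ^ (d + 1) - 1) ∧
      distInt (c * (Q : ℝ) ^ i₀ * q) ≤
        ((Q : ℝ) ^ (K * D))⁻¹ * τ ^ (3 * (2 ^ (d + 1) - 1)) / ((Q : ℝ) ^ m) ^ (d + 1) := by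
  have hQ0 : (0 : ℝ) < Q := by exact_mod_cast hQ
  have hK0 : (0 : ℝ) < K := by exact_mod_cast hK
  have hφ : ∀ z ∈ Z, energy Q (K * D) (c * (Q : ℝ) ^ i₀ * ∏ j, (((z j : ℕ) : ℝ) - s j)) ≤ A := by
    intro z hz
    refine le_trans ?_ (hA z hz)
    calc energy Q (K * D) (c * (Q : ℝ) ^ i₀ * ∏ j, (((z j : ℕ) : ℝ) - s j))
        = ∑ l ∈ Finset.range (K * D),
            distInt (c * (∏ j, (((z j : ℕ) : ℝ) - s j)) * (Q : ℝ) ^ (i₀ + l)) ^ 2 := by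
          refine Finset.sum_congr rfl fun l _ ↦ ?_
          congr 2
          ring
      _ = ∑ l ∈ Finset.Ico i₀ (i₀ + K * D),
            distInt (c * (∏ j, (((z j : ℕ) : ℝ) - s j)) * (Q : ℝ) ^ l) ^ 2 := by
          rw [Finset.sum_Ico_eq_sum_range, Nat.add_sub_cancel_left]
      _ ≤ _ := by
          refine Finset.sum_le_sum_of_subset_of_nonneg ?_ fun _ _ _ ↦ by positivity
          intro l hl
          rw [Finset.mem_Ico] at hl
          exact Finset.mem_range.mpr (by omega)
  obtain ⟨β, Z', _, hcard, hZ'⟩ := exists_cluster hQ hK hD Z _ hφ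
  have h := exists_distInt_mul_le_of_prod (N := Q ^ m) d (c * (Q : ℝ) ^ i₀) β _ τ s hτ
    (by positivity) hτ' (by exact_mod_cast hN) Z' (by
      push_cast
      have h1 : (0 : ℝ) < (6 * Q * K) ^ D := by positivity
      refine le_of_mul_le_mul_left ?_ h1
      calc _ = 8 * ((6 * Q * K) ^ D * ((Q : ℝ) ^ m) ^ (d + 1)) := by ring
        _ ≤ τ * Z.card := hZ
        _ ≤ τ * ((6 * Q * K) ^ D * Z'.card) := by gcongr
        _ = _ := by ring) hZ'
  push_cast at h
  exact h

/-- The first and the last window together: the first one shows that `c * q` is near an integer,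
which makes it possible to divide the approximation of `c * Q ^ i₀ * q` coming from the last window
by `Q ^ i₀`. -/
lemma exists_distInt_le_of_energy_le {Q m d K D : ℕ} {c A τ : ℝ} (hQ : 1 ≤ Q) (hK : 1 ≤ K)
    (hD : 4 * (Q : ℝ) ^ 2 * A ≤ D) (hm : K * D ≤ m) (s : Fin (d + 1) → ℝ)
    (Z : Finset (Fin (d + 1) → Fin (Q ^ m)))
    (hA : ∀ z ∈ Z, energy Q m (c * ∏ j, (((z j : ℕ) : ℝ) - s j)) ≤ A) (hτ : 8 ≤ τ)
    (hZ : 8 * ((6 * Q * K) ^ D * ((Q : ℝ) ^ m) ^ (d + 1)) ≤ τ * Z.card)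
    (hτ' : τ ^ (4 * 2 ^ (d + 1)) ≤ (Q : ℝ) ^ (K * D)) :
    ∃ q : ℕ, 0 < q ∧ (q : ℝ) ≤ τ ^ (2 * 2 ^ (d + 1)) ∧
      distInt (c * q) ≤ τ ^ (4 * 2 ^ (d + 1)) / ((Q : ℝ) ^ m) ^ (d + 2) := by
  have hQ1 : (1 : ℝ) ≤ Q := by exact_mod_cast hQ
  have hQ0 : (0 : ℝ) < Q := by linarith
  have hτ1 : 1 ≤ τ := by linarith
  have hE : 1 ≤ 2 ^ (d + 1) := Nat.one_le_two_pow
  have hE2 : 2 ≤ 2 ^ (d + 1) := by rw [pow_succ]; have := Nat.one_le_two_pow (n := d); omega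
  set E := 2 ^ (d + 1) with hEdef
  set r := K * D with hr
  set Y : ℝ := (Q : ℝ) ^ r with hY
  set N : ℝ := (Q : ℝ) ^ m with hNdef
  have hY0 : 0 < Y := by positivity
  have hN1 : 1 ≤ N := one_le_pow₀ hQ1
  have hN0 : 0 < N := by linarith
  have hYN : Y ≤ N := pow_le_pow_right₀ hQ1 hm
  have h4 : 4 * Y⁻¹ * τ ≤ 1 := by
    have h1 : 4 * τ ≤ τ ^ (4 * E) := by
      calc 4 * τ ≤ τ * τ := by nlinarith
        _ = τ ^ 2 := by ring
        _ ≤ _ := pow_le_pow_right₀ hτ1 (by omega)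
    have h2 : 4 * Y⁻¹ * τ = 4 * τ / Y := by ring
    rw [h2, div_le_one hY0]
    linarith
  have hN : τ ^ (3 * E) ≤ N :=
    (pow_le_pow_right₀ hτ1 (by omega)).trans (hτ'.trans hYN)
  obtain ⟨q₀, hq₀, hq₀τ, h₀⟩ := exists_distInt_le_of_window (i₀ := 0) hQ hK hD (by omega) s Z hA
    hτ hZ h4 hN
  obtain ⟨q₁, hq₁, hq₁τ, h₁⟩ := exists_distInt_le_of_window (i₀ := m - r) hQ hK hD (by omega) s Z
    hA hτ hZ h4 hN
  rw [pow_zero, mul_one] at h₀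
  set ζ : ℝ := Y⁻¹ * τ ^ (3 * (E - 1)) / N ^ (d + 1) with hζ
  have hζ0 : 0 ≤ ζ := by positivity
  have hq : c * ((q₀ * q₁ : ℕ) : ℝ) = c * q₀ * q₁ := by push_cast; ring
  set b : ℝ := c * ((q₀ * q₁ : ℕ) : ℝ) - round (c * ((q₀ * q₁ : ℕ) : ℝ)) with hb
  have hbd : distInt (c * ((q₀ * q₁ : ℕ) : ℝ)) = |b| := rfl
  set P : ℝ := (Q : ℝ) ^ (m - r) with hP
  have hP0 : 0 < P := by positivity
  have hPY : P * Y = N := by rw [hP, hY, ← pow_add, Nat.sub_add_cancel hm]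
  have hb1 : |b| ≤ ζ * τ ^ (E - 1) := by
    rw [← hbd, hq]
    refine (distInt_mul_natCast_le _ _).trans ?_
    gcongr
  have hb2 : |b * P| ≤ 1 / 2 := by
    rw [abs_mul, abs_of_pos hP0]
    have h5 : ζ * τ ^ (E - 1) * P = τ ^ (4 * (E - 1)) / (Y ^ 2 * N ^ d) := by
      rw [hζ, pow_succ N d, ← hPY]
      have : 4 * (E - 1) = 3 * (E - 1) + (E - 1) := by ring
      rw [this, pow_add]
      field_simp
    have h6 : 2 * τ ^ (4 * (E - 1)) ≤ Y := by
      calc 2 * τ ^ (4 * (E - 1)) ≤ τ * τ ^ (4 * (E - 1)) := by gcongr; linarith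
        _ = τ ^ (4 * (E - 1) + 1) := by ring
        _ ≤ τ ^ (4 * E) := pow_le_pow_right₀ hτ1 (by omega)
        _ ≤ Y := hτ'
    have h7 : 1 ≤ Y := one_le_pow₀ hQ1
    have h8 : Y ≤ Y ^ 2 * N ^ d := by
      calc Y = Y * 1 * 1 := by ring
        _ ≤ Y * Y * N ^ d := by gcongr; exact one_le_pow₀ hN1
        _ = _ := by ring
    calc |b| * P ≤ ζ * τ ^ (E - 1) * P := by gcongr
      _ = τ ^ (4 * (E - 1)) / (Y ^ 2 * N ^ d) := h5
      _ ≤ 1 / 2 := by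
        rw [div_le_div_iff₀ (by positivity) (by norm_num)]
        linarith
  have hb3 : |b * P| ≤ ζ * τ ^ (E - 1) := by
    rw [← distInt_of_abs_le hb2]
    have h5 : b * P = c * P * q₁ * q₀ -
        ((round (c * ((q₀ * q₁ : ℕ) : ℝ)) * (Q : ℤ) ^ (m - r) : ℤ) : ℝ) := by
      rw [hb, hP]
      push_cast
      ring
    rw [h5, distInt_sub_intCast]
    refine (distInt_mul_natCast_le _ _).trans ?_
    gcongr
  refine ⟨q₀ * q₁, Nat.mul_pos hq₀ hq₁, ?_, ?_⟩
  · push_cast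
    calc (q₀ : ℝ) * q₁ ≤ τ ^ (E - 1) * τ ^ (E - 1) := by gcongr
      _ = τ ^ (2 * (E - 1)) := by ring
      _ ≤ _ := pow_le_pow_right₀ hτ1 (by omega)
  · rw [hbd]
    rw [abs_mul, abs_of_pos hP0, ← le_div_iff₀ hP0] at hb3
    refine hb3.trans ?_
    have h5 : ζ * τ ^ (E - 1) / P = τ ^ (4 * (E - 1)) / N ^ (d + 2) := by
      have h6 : 4 * (E - 1) = 3 * (E - 1) + (E - 1) := by ring
      rw [hζ, pow_succ N (d + 1), h6, pow_add τ, ← hPY]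
      field_simp
    rw [h5]
    gcongr ?_ / _
    exact pow_le_pow_right₀ hτ1 (by omega)

/-! ### The exponential sum as a sum over independent variables -/

lemma digitSum_cast {Q m : ℕ} (x : Fin m → ℕ) :
    (digitSum Q x : ℝ) = ∑ l, (x l : ℝ) * (Q : ℝ) ^ (l : ℕ) := by
  simp [digitSum]

/-- The Fourier transform of `mu` as an average over all choices of the digits. -/
lemma fourierTransform_mu {b k d₁ d₂ : ℕ} (hk : k ≠ 0) (hd₁ : d₁ < b) (hd₂ : d₂ < b)
    (hne : d₁ ≠ d₂) (n : ℕ) (θ : ℝ) :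
    fourierTransform (mu b k d₁ d₂ n) θ = ((2 : ℂ) ^ n)⁻¹ * ∑ ε : Fin n → Fin 2,
      e (θ * (digitSum b fun i ↦ if ε i = 0 then d₁ else d₂ : ℕ) ^ k) := by
  classical
  let x : (Fin n → Fin 2) → Fin n → ℕ := fun ε i ↦ if ε i = 0 then d₁ else d₂
  have hx : ∀ ε i, x ε i < b := fun ε i ↦ by
    simp only [x]; split_ifs <;> assumption
  let M : (Fin n → Fin 2) → ℤ := fun ε ↦ ((digitSum b (x ε) ^ k : ℕ) : ℤ)
  have hM : Function.Injective M := by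
    intro ε ε' h
    have h1 : digitSum b (x ε) ^ k = digitSum b (x ε') ^ k := Int.natCast_inj.mp h
    have h2 := eq_of_digitSum_eq (hx ε) (hx ε') (Nat.pow_left_injective hk h1)
    funext i
    have h3 := congrFun h2 i
    simp only [x] at h3
    split_ifs at h3 with h4 h5 h5
    · rw [h4, h5]
    · exact absurd h3 hne
    · exact absurd h3.symm hne
    · omega
  have hset : powerSet b k d₁ d₂ n = Set.range M := by
    ext z
    constructor
    · rintro ⟨y, hy, rfl⟩
      refine ⟨fun i ↦ if y i = d₁ then 0 else 1, ?_⟩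
      have h1 : x (fun i ↦ if y i = d₁ then 0 else 1) = y := by
        funext i
        simp only [x]
        rcases hy i with h | h
        · simp [h]
        · simp [h, hne.symm]
      simp only [M, h1]
      simp [digitSum]
    · rintro ⟨ε, rfl⟩
      refine ⟨x ε, fun i ↦ ?_, by simp [M, digitSum]⟩
      simp only [x]
      split_ifs
      · exact Or.inl rfl
      · exact Or.inr rfl
  rw [fourierTransform, tsum_eq_sum (s := Finset.univ.image M) (fun z hz ↦ by
    have h1 : z ∉ powerSet b k d₁ d₂ n := by
      rw [hset]
      simpa using hz
    simp [mu, Set.indicator_of_notMem h1]), Finset.sum_image fun _ _ _ _ h ↦ hM h, Finset.mul_sum]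
  refine Finset.sum_congr rfl fun ε _ ↦ ?_
  have h1 : M ε ∈ powerSet b k d₁ d₂ n := by rw [hset]; exact ⟨ε, rfl⟩
  rw [mu, Set.indicator_of_mem h1]
  push_cast
  congr 2
  simp only [M, x]
  push_cast
  ring

/-- Splitting the digits according to the residue of their position modulo `k`. -/
def splitDigits (m k : ℕ) : (Fin k → Fin m → Fin 2) ≃ (Fin (m * k) → Fin 2) where
  toFun ω i := ω (finProdFinEquiv.symm i).2 (finProdFinEquiv.symm i).1
  invFun ε j l := ε (finProdFinEquiv (l, j))
  left_inv ω := by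
    funext j l
    simp only [Equiv.symm_apply_apply]
  right_inv ε := by
    funext i
    simp only [Prod.mk.eta, Equiv.apply_symm_apply]

lemma digitSum_splitDigits (b d₁ d₂ m k : ℕ) (ω : Fin k → Fin m → Fin 2) :
    ((digitSum b fun i ↦ if splitDigits m k ω i = 0 then d₁ else d₂ : ℕ) : ℝ) =
      ∑ j : Fin k, ((b : ℝ) ^ (j : ℕ) * d₁ * (∑ l : Fin m, ((b ^ k : ℕ) : ℝ) ^ (l : ℕ)) +
        (b : ℝ) ^ (j : ℕ) * ((d₂ : ℝ) - d₁) * digitSum (b ^ k) (fun l ↦ (ω j l : ℕ))) := by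
  have h2 : ∀ a : Fin 2, ((if a = 0 then d₁ else d₂ : ℕ) : ℝ) = d₁ + (d₂ - d₁) * (a : ℕ) := by
    intro a
    fin_cases a <;> simp
  rw [digitSum_cast, ← finProdFinEquiv.sum_comp, Fintype.sum_prod_type, Finset.sum_comm]
  refine Finset.sum_congr rfl fun j _ ↦ ?_
  rw [digitSum_cast, Finset.mul_sum, Finset.mul_sum, ← Finset.sum_add_distrib]
  refine Finset.sum_congr rfl fun l _ ↦ ?_
  rw [h2]
  have h3 : splitDigits m k ω (finProdFinEquiv (l, j)) = ω j l := by
    simp only [splitDigits, Equiv.coe_fn_mk, Equiv.symm_apply_apply]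
  have h4 : ((finProdFinEquiv (l, j) : Fin (m * k)) : ℕ) = j + k * l := rfl
  rw [h3, h4]
  push_cast
  rw [pow_add, pow_mul]
  ring

/-! ### Choice of parameters -/

/-- The numerical inequality that makes all losses fit into the exponent `b ^ (6 * k ^ 2)`, for
`k = d + 2`. -/
lemma pow_mul_pow_le_pow {b d D : ℕ} (hb : 3 ≤ b) {T : ℝ} (hT : 2 ≤ T)
    (hD : (D : ℝ) ≤ 4 * ((b : ℝ) ^ (d + 2)) ^ 2 * (((b : ℝ) ^ (d + 2)) ^ 2) ^ (d + 1) *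
      (2 ^ (d + 1) * Real.log T) + 1) :
    (((b : ℝ) ^ (d + 2)) ^ (6 * D)) ^ (8 * 2 ^ (d + 1)) * (b : ℝ) ^ (2 * (d + 2) ^ 2) ≤
      T ^ b ^ (6 * (d + 2) ^ 2) := by
  obtain ⟨k, hk⟩ : ∃ k, k = d + 2 := ⟨_, rfl⟩
  have hk2 : 2 ≤ k := by omega
  have hb3 : (3 : ℝ) ≤ b := by exact_mod_cast hb
  have hb1 : (1 : ℝ) ≤ b := by linarith
  have hb0 : (0 : ℝ) < b := by linarith
  set ℓ := Real.log T with hℓ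
  have hℓ1 : 1 / 2 ≤ ℓ := by
    have h1 := Real.log_le_log (by norm_num) hT
    have h2 := Real.log_two_gt_d9
    linarith
  have hlogb : Real.log b ≤ b := (Real.log_le_sub_one_of_pos hb0).trans (by linarith)
  have h2k : (2 : ℝ) ^ (d + 1) * 2 = 2 ^ k := by rw [hk]; ring
  have h2kb : (2 : ℝ) ^ k ≤ (b : ℝ) ^ k := by gcongr; linarith
  have hkb : (k : ℝ) ≤ (b : ℝ) ^ k := by
    refine le_trans ?_ h2kb
    exact_mod_cast Nat.lt_two_pow_self.le
  have hb2k : ((b : ℝ) ^ (d + 2)) ^ 2 * (((b : ℝ) ^ (d + 2)) ^ 2) ^ (d + 1)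
      = (b : ℝ) ^ (2 * k ^ 2) := by
    rw [hk]
    ring
  set X : ℝ := (b : ℝ) ^ (2 * k ^ 2) with hX
  have hX1 : 1 ≤ X := one_le_pow₀ hb1
  have h2k1 : (1 : ℝ) ≤ 2 ^ (d + 1) := one_le_pow₀ (by norm_num)
  have hD' : (D : ℝ) ≤ 6 * 2 ^ (d + 1) * X * ℓ := by
    have h1 : 4 * ((b : ℝ) ^ (d + 2)) ^ 2 * (((b : ℝ) ^ (d + 2)) ^ 2) ^ (d + 1) *
      (2 ^ (d + 1) * ℓ) = 4 * 2 ^ (d + 1) * X * ℓ := by rw [← hb2k]; ring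
    rw [h1] at hD
    have h2 : 1 ≤ 2 ^ (d + 1) * X := one_le_mul_of_one_le_of_one_le h2k1 hX1
    nlinarith
  have hL : (((b : ℝ) ^ (d + 2)) ^ (6 * D)) ^ (8 * 2 ^ (d + 1)) * (b : ℝ) ^ (2 * (d + 2) ^ 2)
      = (b : ℝ) ^ (k * (6 * D) * (8 * 2 ^ (d + 1)) + 2 * k ^ 2) := by
    rw [← pow_mul, ← pow_mul, ← pow_add, hk, mul_assoc (d + 2)]
  rw [hL, ← hk, ← Real.log_le_log_iff (by positivity) (by positivity), Real.log_pow, Real.log_pow]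
  push_cast
  have h4k : (2 : ℝ) ^ k * 2 ^ k ≤ (b : ℝ) ^ (2 * k) := by
    rw [two_mul, pow_add]
    gcongr
  have hX2 : (k : ℝ) ^ 2 ≤ (b : ℝ) ^ (3 * k) * X := by
    calc (k : ℝ) ^ 2 ≤ ((b : ℝ) ^ k) ^ 2 := by gcongr
      _ = (b : ℝ) ^ (2 * k) * 1 := by ring
      _ ≤ _ := by gcongr; omega
  have h80 : (80 : ℝ) ≤ (b : ℝ) ^ 4 := by
    calc (80 : ℝ) ≤ 3 ^ 4 := by norm_num
      _ ≤ _ := by gcongr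
  calc (k * (6 * D) * (8 * 2 ^ (d + 1)) + 2 * (k : ℝ) ^ 2) * Real.log b
      ≤ (k * (6 * (6 * 2 ^ (d + 1) * X * ℓ)) * (8 * 2 ^ (d + 1)) + 2 * (k : ℝ) ^ 2) * b := by
        gcongr
    _ = (72 * (k * (2 ^ (d + 1) * 2 * (2 ^ (d + 1) * 2)) * X) * ℓ + 2 * (k : ℝ) ^ 2) * b := by
        ring
    _ ≤ (72 * ((b : ℝ) ^ k * (b : ℝ) ^ (2 * k) * X) * ℓ
          + 2 * ((b : ℝ) ^ (3 * k) * X)) * b := by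
        rw [h2k]
        gcongr
    _ ≤ 80 * ((b : ℝ) ^ (3 * k) * X) * ℓ * b := by
        have h1 : (b : ℝ) ^ k * (b : ℝ) ^ (2 * k) = (b : ℝ) ^ (3 * k) := by ring
        rw [h1]
        have h2 : 0 ≤ (b : ℝ) ^ (3 * k) * X := by positivity
        gcongr
        nlinarith
    _ ≤ (b : ℝ) ^ 4 * ((b : ℝ) ^ (3 * k) * X) * ℓ * b := by gcongr
    _ = (b : ℝ) ^ (2 * k ^ 2 + 3 * k + 5) * ℓ := by rw [hX]; ring
    _ ≤ (b : ℝ) ^ (6 * k ^ 2) * ℓ := by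
        gcongr
        nlinarith

/-- The bound for exponential sums over two-digit integers, in terms of `τ = Q ^ (6 * D)`, where `D`
bounds the number of nonzero digits and `Q = b ^ k`, `k = d + 2`. The window length is
`48 * 2 ^ (d + 1) * D`, so that arcs of length `τ ^ (-8 * 2 ^ (d + 1))` are obtained, whereas all
densities stay above `8 / τ`. -/
lemma exists_distInt_le_of_le_norm_sum {Q m d D : ℕ} {θ δ : ℝ} (hQ9 : 9 ≤ Q)
    (hQ2 : 2 ^ (d + 2) ≤ Q) (hδ : 0 < δ) (hδ1 : δ < 1)
    (hD : 4 * (Q : ℝ) ^ 2 * ((Q : ℝ) ^ 2) ^ (d + 1) * (2 ^ (d + 1) * Real.log (2 / δ)) ≤ D)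
    (hm : 48 * 2 ^ (d + 1) * D ≤ m) (x₀ x₁ : Fin (d + 2) → ℝ)
    (h : δ * ((2 : ℝ) ^ m) ^ (d + 2) ≤ ‖∑ ω : Fin (d + 2) → Fin m → Fin 2,
      e (θ * (∑ j, (x₀ j + x₁ j * digitSum Q (fun l ↦ (ω j l : ℕ)))) ^ (d + 2))‖) :
    ∃ q : ℕ, 0 < q ∧ (q : ℝ) ≤ ((Q : ℝ) ^ (6 * D)) ^ (2 * 2 ^ (d + 1)) ∧
      distInt (θ * (d + 2).factorial * (∏ j, x₁ j) * q) ≤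
        ((Q : ℝ) ^ (6 * D)) ^ (4 * 2 ^ (d + 1)) / ((Q : ℝ) ^ m) ^ (d + 2) := by
  have hQ9' : (9 : ℝ) ≤ Q := by exact_mod_cast hQ9
  have hQ1 : (1 : ℝ) ≤ Q := by linarith
  have hQ0 : (0 : ℝ) < Q := by linarith
  have hT2 : 2 ≤ 2 / δ := by
    rw [le_div_iff₀ hδ]
    linarith
  set W : ℝ := 2 ^ (d + 1) * Real.log (2 / δ) with hW
  have hlog : 0 < Real.log (2 / δ) := Real.log_pos (by linarith)
  have hW0 : 0 < W := by positivity
  obtain ⟨s, S, hS, hSen⟩ := exists_energy_le_of_le_norm_sum hδ x₀ x₁ h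
  set κ : ℝ := δ ^ 2 ^ (d + 1) / 2 with hκ
  have hκ0 : 0 < κ := by positivity
  have hlogκ : Real.log κ⁻¹ ≤ W := by
    have h1 : κ⁻¹ ≤ (2 / δ) ^ 2 ^ (d + 1) := by
      rw [hκ, inv_div, div_pow]
      gcongr
      exact le_self_pow₀ (by norm_num) (by positivity)
    have h2 := Real.log_le_log (by positivity) h1
    rw [Real.log_pow] at h2
    push_cast at h2
    exact h2
  have hκexp : Real.exp (-W) ≤ κ := by
    rw [← Real.le_log_iff_exp_le hκ0]
    rw [Real.log_inv] at hlogκ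
    linarith
  obtain ⟨Z, hZ, hZen⟩ := exists_energy_le_of_digitSum (by omega) (d + 1) _ s S κ
    (Real.log κ⁻¹ / 2) hκ0.le hS hSen
  have hQs : ((Q - 1 : ℕ) : ℝ) ≤ Q := by exact_mod_cast Nat.sub_le Q 1
  have hD4 : 4 * (Q : ℝ) ^ 2 * ((((Q - 1 : ℕ) : ℝ) ^ 2) ^ (d + 1) * (Real.log κ⁻¹ / 2)) ≤ D := by
    refine le_trans ?_ hD
    have h1 : Real.log κ⁻¹ / 2 ≤ W := by linarith
    calc 4 * (Q : ℝ) ^ 2 * ((((Q - 1 : ℕ) : ℝ) ^ 2) ^ (d + 1) * (Real.log κ⁻¹ / 2))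
        ≤ 4 * (Q : ℝ) ^ 2 * ((((Q - 1 : ℕ) : ℝ) ^ 2) ^ (d + 1) * W) := by gcongr
      _ ≤ 4 * (Q : ℝ) ^ 2 * (((Q : ℝ) ^ 2) ^ (d + 1) * W) := by gcongr
      _ = _ := by ring
  have hDpos : 0 < D := by
    have h1 : (0 : ℝ) < D := lt_of_lt_of_le (by positivity) hD
    exact_mod_cast h1
  -- The density of `Z` is at least `3 ^ (-D)`.
  have hdens : ((3 : ℝ) ^ D)⁻¹ ≤ κ ^ (Q - 1) ^ (d + 1) := by
    have h1 : W * (Q : ℝ) ^ (d + 1) ≤ D := by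
      refine le_trans ?_ hD
      have h2 : (1 : ℝ) ≤ (Q : ℝ) ^ 2 := one_le_pow₀ hQ1
      have h3 : (Q : ℝ) ^ (d + 1) ≤ ((Q : ℝ) ^ 2) ^ (d + 1) := by
        gcongr
        exact le_self_pow₀ hQ1 (by norm_num)
      calc W * (Q : ℝ) ^ (d + 1) ≤ W * ((Q : ℝ) ^ 2) ^ (d + 1) := by gcongr
        _ = 1 * ((Q : ℝ) ^ 2) ^ (d + 1) * W := by ring
        _ ≤ 4 * (Q : ℝ) ^ 2 * ((Q : ℝ) ^ 2) ^ (d + 1) * W := by gcongr; linarith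
    have h4 : ((Q - 1 : ℕ) : ℝ) ^ (d + 1) ≤ (Q : ℝ) ^ (d + 1) := by gcongr
    calc ((3 : ℝ) ^ D)⁻¹ ≤ (Real.exp 1 ^ D)⁻¹ := by
          gcongr
          linarith [Real.exp_one_lt_d9]
      _ = Real.exp (-D) := by rw [← Real.exp_nat_mul, mul_one, Real.exp_neg]
      _ ≤ Real.exp (-W) ^ (Q - 1) ^ (d + 1) := by
          rw [← Real.exp_nat_mul, Real.exp_le_exp]
          push_cast
          nlinarith
      _ ≤ _ := by gcongr
  have hKbound : (48 * 2 ^ (d + 1) : ℕ) ≤ 24 * Q := by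
    rw [pow_succ] at hQ2
    omega
  have hKbound' : ((48 * 2 ^ (d + 1) : ℕ) : ℝ) ≤ 24 * Q := by exact_mod_cast hKbound
  refine exists_distInt_le_of_energy_le (K := 48 * 2 ^ (d + 1)) (A := _) (by omega) ?_ hD4 hm
    (fun j ↦ (Q - 1 : ℕ) * s j) Z hZen ?_ ?_ ?_
  · have := Nat.one_le_two_pow (n := d + 1)
    omega
  · calc (8 : ℝ) ≤ Q := by linarith
      _ ≤ _ := le_self_pow₀ hQ1 (by omega)
  · have h1 : 8 * (6 * (Q : ℝ) * (48 * 2 ^ (d + 1) : ℕ)) ^ D * 3 ^ D ≤ (Q : ℝ) ^ (6 * D) := by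
      calc 8 * (6 * (Q : ℝ) * (48 * 2 ^ (d + 1) : ℕ)) ^ D * 3 ^ D
          ≤ 8 ^ D * (6 * (Q : ℝ) * (24 * Q)) ^ D * 3 ^ D := by
            gcongr
            exact le_self_pow₀ (by norm_num) hDpos.ne'
        _ = (3456 * Q ^ 2) ^ D := by
            rw [← mul_pow, ← mul_pow]
            congr 1
            ring
        _ ≤ ((Q : ℝ) ^ 6) ^ D := by
            gcongr
            calc 3456 * (Q : ℝ) ^ 2 ≤ 9 ^ 4 * (Q : ℝ) ^ 2 := by gcongr; norm_num
              _ ≤ (Q : ℝ) ^ 4 * Q ^ 2 := by gcongr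
              _ = (Q : ℝ) ^ 6 := by ring
        _ = _ := by rw [← pow_mul]
    have h2 : ((3 : ℝ) ^ D)⁻¹ * ((Q : ℝ) ^ m) ^ (d + 1) ≤ Z.card :=
      le_trans (by gcongr) hZ
    calc 8 * ((6 * (Q : ℝ) * (48 * 2 ^ (d + 1) : ℕ)) ^ D * ((Q : ℝ) ^ m) ^ (d + 1))
        = (8 * (6 * (Q : ℝ) * (48 * 2 ^ (d + 1) : ℕ)) ^ D * 3 ^ D) *
            (((3 : ℝ) ^ D)⁻¹ * ((Q : ℝ) ^ m) ^ (d + 1)) := by field_simp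
      _ ≤ _ := mul_le_mul h1 h2 (by positivity) (by positivity)
  · rw [← pow_mul]
    refine pow_le_pow_right₀ hQ1 (le_of_eq_of_le (b := 24 * 2 ^ (d + 1) * D) (by ring) ?_)
    gcongr
    norm_num

end RestrictedDigits

open RestrictedDigits in
theorem proposition2p1
    (b k d₁ d₂ : ℕ) (hb : 3 ≤ b) (hk : 2 ≤ k)
    (hd₁ : d₁ < b) (hd₂ : d₂ < b) (hne : d₁ ≠ d₂) (hcop : Nat.Coprime d₁ d₂)
    (n : ℕ) (hkn : k ∣ n)
    (δ : ℝ) (hδ₀ : 0 < δ) (hδ₁ : δ < 1)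
    (hN : (2 / δ) ^ (b ^ (6 * k ^ 2)) ≤ (b : ℝ) ^ n)
    (θ : ℝ)
    (hθ : δ ≤ ‖RestrictedDigits.fourierTransform (RestrictedDigits.mu b k d₁ d₂ n) θ‖) :
    ∃ q : ℕ, 0 < q ∧ (q : ℝ) ≤ (2 / δ) ^ (b ^ (6 * k ^ 2)) ∧
      RestrictedDigits.distInt (θ * q) ≤
        (2 / δ) ^ (b ^ (6 * k ^ 2)) * (((b : ℝ) ^ n) ^ k)⁻¹ := by
  obtain ⟨m, hm⟩ := hkn
  obtain rfl : n = m * k := by rw [hm, mul_comm]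
  clear hm
  obtain ⟨d, rfl⟩ : ∃ d, k = d + 2 := ⟨k - 2, by omega⟩
  have hb1 : (1 : ℝ) ≤ b := by exact_mod_cast (by omega : 1 ≤ b)
  have hb0 : (0 : ℝ) < b := by linarith
  have hT2 : 2 ≤ 2 / δ := by
    rw [le_div_iff₀ hδ₀]
    linarith
  set T := 2 / δ with hT
  set Q : ℕ := b ^ (d + 2) with hQ
  have hQr : (Q : ℝ) = (b : ℝ) ^ (d + 2) := by rw [hQ]; push_cast; rfl
  have hQ9 : 9 ≤ Q := by
    calc 9 = 3 ^ 2 := by norm_num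
      _ ≤ 3 ^ (d + 2) := Nat.pow_le_pow_right (by norm_num) (by omega)
      _ ≤ _ := Nat.pow_le_pow_left hb _
  have hQ2 : 2 ^ (d + 2) ≤ Q := Nat.pow_le_pow_left (by omega) _
  have hQ1 : (1 : ℝ) ≤ Q := by exact_mod_cast (by omega : 1 ≤ Q)
  have hNQ : (b : ℝ) ^ (m * (d + 2)) = (Q : ℝ) ^ m := by rw [hQr, ← pow_mul, mul_comm]
  set V : ℝ := 4 * (Q : ℝ) ^ 2 * ((Q : ℝ) ^ 2) ^ (d + 1) * (2 ^ (d + 1) * Real.log T) with hV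
  have hV0 : 0 ≤ V := by
    have : 0 ≤ Real.log T := Real.log_nonneg (by linarith)
    positivity
  set D : ℕ := ⌈V⌉₊ with hD
  have hDV : V ≤ D := Nat.le_ceil _
  have hDV' : (D : ℝ) ≤ V + 1 := (Nat.ceil_lt_add_one hV0).le
  have hbound := pow_mul_pow_le_pow hb hT2 (D := D) (d := d) (by rw [← hQr]; exact hDV')
  rw [← hQr] at hbound
  set B := b ^ (6 * (d + 2) ^ 2) with hB
  set τ : ℝ := (Q : ℝ) ^ (6 * D) with hτ
  have hτ1 : 1 ≤ τ := one_le_pow₀ hQ1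
  have hv1 : (1 : ℝ) ≤ (b : ℝ) ^ (2 * (d + 2) ^ 2) := one_le_pow₀ hb1
  have hmD : 48 * 2 ^ (d + 1) * D ≤ m := by
    have h1 : (Q : ℝ) ^ (48 * 2 ^ (d + 1) * D) ≤ (Q : ℝ) ^ m := by
      calc (Q : ℝ) ^ (48 * 2 ^ (d + 1) * D) = τ ^ (8 * 2 ^ (d + 1)) * 1 := by
            rw [hτ, ← pow_mul, mul_one]
            congr 1
            ring
        _ ≤ τ ^ (8 * 2 ^ (d + 1)) * (b : ℝ) ^ (2 * (d + 2) ^ 2) := by gcongr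
        _ ≤ T ^ B := hbound
        _ ≤ _ := by rw [← hNQ]; exact hN
    have hQ1' : 1 < Q := by omega
    exact (Nat.pow_le_pow_iff_right hQ1').mp (by exact_mod_cast h1)
  rw [fourierTransform_mu (by omega) hd₁ hd₂ hne, ← (splitDigits m (d + 2)).sum_comp] at hθ
  simp only [digitSum_splitDigits] at hθ
  rw [norm_mul, norm_inv, norm_pow, Complex.norm_ofNat, inv_mul_eq_div, le_div_iff₀ (by positivity),
    pow_mul] at hθ
  obtain ⟨q, hq0, hq1, hq2⟩ := exists_distInt_le_of_le_norm_sum hQ9 hQ2 hδ₀ hδ₁ hDV hmD _ _ hθ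
  -- The factor that the differencing puts in front of `θ` is an integer `v`.
  let v : ℤ := (d + 2).factorial * ∏ j : Fin (d + 2), ((b : ℤ) ^ (j : ℕ) * ((d₂ : ℤ) - d₁))
  have hv0 : v ≠ 0 := by
    refine mul_ne_zero (by exact_mod_cast Nat.factorial_ne_zero _) ?_
    refine Finset.prod_ne_zero_iff.mpr fun j _ ↦ mul_ne_zero (pow_ne_zero _ (by omega)) ?_
    omega
  have hvle : (v.natAbs : ℝ) ≤ (b : ℝ) ^ (2 * (d + 2) ^ 2) := by
    have h1 : ((d + 2).factorial : ℝ) ≤ (b : ℝ) ^ ((d + 2) * (d + 2)) := by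
      have h2 : (d + 2).factorial ≤ b ^ ((d + 2) * (d + 2)) := by
        calc (d + 2).factorial ≤ (d + 2) ^ (d + 2) := Nat.factorial_le_pow _
          _ ≤ (b ^ (d + 2)) ^ (d + 2) :=
            Nat.pow_le_pow_left (Nat.lt_two_pow_self.le.trans hQ2) _
          _ = _ := by rw [← pow_mul]
      exact_mod_cast h2
    have h3 : ∏ j : Fin (d + 2), |(b : ℝ) ^ (j : ℕ) * ((d₂ : ℝ) - d₁)|
        ≤ ∏ _j : Fin (d + 2), (b : ℝ) ^ (d + 2) := by
      refine Finset.prod_le_prod (fun _ _ ↦ abs_nonneg _) fun j _ ↦ ?_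
      rw [abs_mul, abs_of_pos (by positivity)]
      have h4 : |(d₂ : ℝ) - d₁| ≤ b := by
        have h5 : (d₁ : ℝ) < b := by exact_mod_cast hd₁
        have h6 : (d₂ : ℝ) < b := by exact_mod_cast hd₂
        have h7 : (0 : ℝ) ≤ d₁ := Nat.cast_nonneg _
        have h8 : (0 : ℝ) ≤ d₂ := Nat.cast_nonneg _
        rw [abs_le]
        constructor <;> linarith
      calc (b : ℝ) ^ (j : ℕ) * |(d₂ : ℝ) - d₁| ≤ (b : ℝ) ^ (j : ℕ) * b := by gcongr
        _ = (b : ℝ) ^ ((j : ℕ) + 1) := by ring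
        _ ≤ _ := pow_le_pow_right₀ hb1 (by have := j.isLt; omega)
    rw [Nat.cast_natAbs, Int.cast_abs]
    simp only [v]
    push_cast
    rw [abs_mul, Nat.abs_cast, Finset.abs_prod]
    calc _ ≤ (b : ℝ) ^ ((d + 2) * (d + 2)) * ∏ _j : Fin (d + 2), (b : ℝ) ^ (d + 2) := by gcongr
      _ = _ := by
        rw [Finset.prod_const, Finset.card_univ, Fintype.card_fin, ← pow_mul, ← pow_add]
        congr 1
        ring
  have hvq : distInt (θ * ((v.natAbs * q : ℕ) : ℝ)) = distInt (θ * (d + 2).factorial *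
      (∏ j : Fin (d + 2), ((b : ℝ) ^ (j : ℕ) * ((d₂ : ℝ) - d₁))) * q) := by
    have h1 : θ * (d + 2).factorial *
      (∏ j : Fin (d + 2), ((b : ℝ) ^ (j : ℕ) * ((d₂ : ℝ) - d₁))) * q = θ * (v : ℝ) * q := by
      simp only [v]
      push_cast
      ring
    rw [h1, Nat.cast_mul, Nat.cast_natAbs, Int.cast_abs, ← mul_assoc]
    rcases abs_choice (v : ℝ) with h2 | h2
    · rw [h2]
    · rw [h2, mul_neg, neg_mul, distInt_neg]
  refine ⟨v.natAbs * q, Nat.mul_pos (Int.natAbs_pos.mpr hv0) hq0, ?_, ?_⟩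
  · push_cast
    calc (v.natAbs : ℝ) * q ≤ (b : ℝ) ^ (2 * (d + 2) ^ 2) * τ ^ (2 * 2 ^ (d + 1)) := by gcongr
      _ ≤ (b : ℝ) ^ (2 * (d + 2) ^ 2) * τ ^ (8 * 2 ^ (d + 1)) := by
          gcongr
          norm_num
      _ ≤ _ := by rw [mul_comm]; exact hbound
  · rw [hvq, hNQ, ← div_eq_mul_inv]
    refine hq2.trans ?_
    gcongr ?_ / _
    calc τ ^ (4 * 2 ^ (d + 1)) ≤ τ ^ (8 * 2 ^ (d + 1)) * 1 := by
          rw [mul_one]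
          gcongr
          norm_num
      _ ≤ τ ^ (8 * 2 ^ (d + 1)) * (b : ℝ) ^ (2 * (d + 2) ^ 2) := by gcongr
      _ ≤ _ := hbound
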